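/- Let $k$ be a field, $n\ge 0$ an integer, and let $R=k\langle x_0,\dots,x_n\rangle$ be the free algebra, $\mathbb Z$-graded by $\deg x_i=1$. Let $\mathsf{Gr}\,R$ be the category of $\mathbb Z$-graded left $R$-modules with degree-preserving homomorphisms, $\mathsf{Fdim}\,R$ its Serre subcategory of direct limits (equivalently, unions) of finite-dimensional graded modules, $\pi^*:\mathsf{Gr}\,R\to\mathsf{QGr}\,R:=\mathsf{Gr}\,R/\mathsf{Fdim}\,R$ the quotient functor, and $\mathcal O:=\pi^*R$. For $i\ge 0$ let $R_{\ge i}=\bigoplus_{j\ge i}R_j$. Then: 1. $\mathcal O$ is a progenerator in $\mathsf{QGr}\,R$, that is, it is projective, it is a generator, and it is finitely generated: whenever $\mathcal O$ is the sum of a directed family of subobjects, it is equal to one of them. 2. The functor $\operatorname{Hom}_{\mathsf{QGr}\,R}(\mathcal O,-)$ is an equivalence from $\mathsf{QGr}\,R$ to the category of right modules over the ring $\operatorname{End}_{\mathsf{QGr}\,R}\mathcal O$. 3. There is an isomorphism of $k$-algebras $$\operatorname{End}_{\mathsf{QGr}\,R}\mathcal O\;\cong\;\varinjlim_i \operatorname{End}_{\mathsf{Gr}\,R}(R_{\ge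 i}),$$ the direct limit being taken along the restriction maps $\theta_i:\operatorname{End}_{\mathsf{Gr}\,R}(R_{\ge i})\to\operatorname{End}_{\mathsf{Gr}\,R}(R_{\ge i+1})$, $\theta_i(f)=f|_{R_{\ge i+1}}$. More precisely, $\pi^*$ sends each inclusion $\iota_i:R_{\ge i}\to R$ to an isomorphism, and the isomorphism can be chosen so that the class of $f\in\operatorname{End}_{\mathsf{Gr}\,R}(R_{\ge i})$ corresponds to $\pi^*(\iota_i)\circ\pi^*(f)\circ\pi^*(\iota_i)^{-1}$. -/

import Mathlib

open CategoryTheory CategoryTheory.Limits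

universe u

section GradedModules

variable {k A : Type u} [Field k] [Ring A] [Algebra k A]

/-- A `ℤ`-graded left module over the `k`-algebra `A` with grading `𝒜`: a left `A`-module that is
the internal direct sum of `k`-subspaces `deg i`, `i ∈ ℤ`, with `𝒜 i • deg j ⊆ deg (i + j)`. -/
structure GrMod (𝒜 : ℤ → Submodule k A) where
  carrier : Type u
  [addCommGroup : AddCommGroup carrier]
  [moduleBase : Module k carrier]
  [module : Module A carrier]
  [tower : IsScalarTower k A carrier]
  deg : ℤ → Submodule k carrier
  isInternal : DirectSum.IsInternal deg
  smul_mem : ∀ (i j : ℤ) (a : A) (m : carrier), a ∈ 𝒜 i → m ∈ deg j → a • m ∈ deg (i + j)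

namespace GrMod

variable {𝒜 : ℤ → Submodule k A}

instance : CoeSort (GrMod 𝒜) (Type u) := ⟨carrier⟩

attribute [instance] addCommGroup moduleBase module tower

/-- A morphism of graded modules: an `A`-linear map that preserves degrees. -/
@[ext]
structure Hom (M N : GrMod 𝒜) where
  toLin : M →ₗ[A] N
  map_mem : ∀ (i : ℤ) (m : M), m ∈ M.deg i → toLin m ∈ N.deg i

/-- The category of `ℤ`-graded left `A`-modules and degree-preserving `A`-linear maps. -/
instance : Category.{u} (GrMod 𝒜) where
  Hom M N := Hom M N
  id M := ⟨LinearMap.id, fun _ _ h => h⟩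
  comp f g := ⟨g.toLin ∘ₗ f.toLin, fun i m h => g.map_mem i _ (f.map_mem i m h)⟩

/-- The linear map underlying a morphism. -/
def lin {M N : GrMod 𝒜} (f : M ⟶ N) : M →ₗ[A] N := Hom.toLin f

/-- The morphism given by a degree-preserving linear map. -/
def homMk {M N : GrMod 𝒜} (f : M →ₗ[A] N) (hf : ∀ (i : ℤ) (m : M), m ∈ M.deg i → f m ∈ N.deg i) :
    M ⟶ N := Hom.mk f hf

theorem lin_mem {M N : GrMod 𝒜} (f : M ⟶ N) {i : ℤ} {m : M} (h : m ∈ M.deg i) :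
    lin f m ∈ N.deg i := Hom.map_mem f i m h

theorem hom_ext' {M N : GrMod 𝒜} {f g : M ⟶ N} (h : ∀ m, lin f m = lin g m) : f = g :=
  Hom.ext (LinearMap.ext h)

@[simp] theorem lin_homMk {M N : GrMod 𝒜} (f : M →ₗ[A] N) (hf) (m : M) :
    lin (homMk f hf : M ⟶ N) m = f m := rfl

@[simp] theorem lin_id (M : GrMod 𝒜) (m : M) : lin (𝟙 M) m = m := rfl

@[simp] theorem lin_comp {M N P : GrMod 𝒜} (f : M ⟶ N) (g : N ⟶ P) (m : M) :
    lin (f ≫ g) m = lin g (lin f m) := rfl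

theorem lin_smul_base {M N : GrMod 𝒜} (f : M ⟶ N) (c : k) (m : M) :
    lin f (c • m) = c • lin f m :=
  LinearMap.map_smul_of_tower (lin f) c m

section Preadditive

variable (M N : GrMod 𝒜)

instance : Zero (M ⟶ N) := ⟨homMk 0 fun i _ _ => (N.deg i).zero_mem⟩

instance : Add (M ⟶ N) :=
  ⟨fun f g => homMk (lin f + lin g) fun i _ h => (N.deg i).add_mem (lin_mem f h) (lin_mem g h)⟩

instance : Neg (M ⟶ N) :=
  ⟨fun f => homMk (-lin f) fun i _ h => (N.deg i).neg_mem (lin_mem f h)⟩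

instance : SMul k (M ⟶ N) :=
  ⟨fun c f => homMk
    { toFun := fun m => c • lin f m
      map_add' := fun x y => by rw [map_add, smul_add]
      map_smul' := fun a x => by
        rw [map_smul, RingHom.id_apply, ← algebraMap_smul A c, ← algebraMap_smul A c, smul_smul,
          smul_smul, Algebra.commutes] }
    fun i _ h => (N.deg i).smul_mem c (lin_mem f h)⟩

variable {M N}

@[simp] theorem lin_zero (m : M) : lin (0 : M ⟶ N) m = 0 := rfl

@[simp] theorem lin_add (f g : M ⟶ N) (m : M) : lin (f + g) m = lin f m + lin g m := rfl

@[simp] theorem lin_neg (f : M ⟶ N) (m : M) : lin (-f) m = -lin f m := rfl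

@[simp] theorem lin_smul (c : k) (f : M ⟶ N) (m : M) : lin (c • f) m = c • lin f m := rfl

variable (M N)

instance : AddCommGroup (M ⟶ N) where
  add_assoc _ _ _ := hom_ext' fun _ => add_assoc _ _ _
  zero_add _ := hom_ext' fun _ => zero_add _
  add_zero _ := hom_ext' fun _ => add_zero _
  add_comm _ _ := hom_ext' fun _ => add_comm _ _
  neg_add_cancel _ := hom_ext' fun _ => neg_add_cancel _
  nsmul := nsmulRec
  zsmul := zsmulRec

instance : Module k (M ⟶ N) where
  one_smul _ := hom_ext' fun _ => one_smul _ _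
  mul_smul _ _ _ := hom_ext' fun _ => mul_smul _ _ _
  smul_zero _ := hom_ext' fun _ => smul_zero _
  smul_add _ _ _ := hom_ext' fun _ => smul_add _ _ _
  add_smul _ _ _ := hom_ext' fun _ => add_smul _ _ _
  zero_smul _ := hom_ext' fun _ => zero_smul _ _

end Preadditive

instance : Preadditive (GrMod 𝒜) where
  add_comp _ _ _ f g h := hom_ext' fun m => by simp
  comp_add _ _ _ f g h := hom_ext' fun m => by simp

instance : Linear k (GrMod 𝒜) where
  smul_comp _ _ _ c f g := hom_ext' fun m => by simp
  comp_smul _ _ _ f c g := hom_ext' fun m => by simp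

/-- The projection of a graded module onto its component of degree `i`. -/
noncomputable def proj (M : GrMod 𝒜) (i : ℤ) : M →ₗ[k] M :=
  letI := M.isInternal.chooseDecomposition
  (M.deg i).subtype ∘ₗ DirectSum.component k ℤ (fun j => M.deg j) i ∘ₗ
    (DirectSum.decomposeLinearEquiv M.deg).toLinearMap

theorem proj_mem (M : GrMod 𝒜) (i : ℤ) (m : M) : M.proj i m ∈ M.deg i :=
  Subtype.coe_prop _

theorem proj_of_mem (M : GrMod 𝒜) {i : ℤ} {m : M} (h : m ∈ M.deg i) : M.proj i m = m := by
  let _ := M.isInternal.chooseDecomposition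
  exact DirectSum.decompose_of_mem_same M.deg h

theorem proj_of_mem_ne (M : GrMod 𝒜) {i j : ℤ} {m : M} (h : m ∈ M.deg i) (hij : i ≠ j) :
    M.proj j m = 0 := by
  let _ := M.isInternal.chooseDecomposition
  exact DirectSum.decompose_of_mem_ne M.deg h hij

theorem exists_sum_proj (M : GrMod 𝒜) (m : M) : ∃ s : Finset ℤ, ∑ i ∈ s, M.proj i m = m := by
  let _ := M.isInternal.chooseDecomposition
  classical
  exact ⟨_, DirectSum.sum_support_decompose M.deg m⟩

theorem induction_on (M : GrMod 𝒜) {p : M → Prop} (m : M) (h0 : p 0)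
    (hadd : ∀ x y, p x → p y → p (x + y)) (hdeg : ∀ i, ∀ x ∈ M.deg i, p x) : p m := by
  obtain ⟨s, hs⟩ := M.exists_sum_proj m
  rw [← hs]
  exact Finset.sum_induction _ p hadd h0 fun i _ => hdeg i _ (M.proj_mem i m)

theorem lin_proj {M N : GrMod 𝒜} (f : M ⟶ N) (i : ℤ) (m : M) :
    lin f (M.proj i m) = N.proj i (lin f m) := by
  induction m using M.induction_on with
  | h0 => simp
  | hadd x y hx hy => simp [hx, hy]
  | hdeg j x hx =>
    by_cases h : j = i
    · subst h
      rw [M.proj_of_mem hx, N.proj_of_mem (lin_mem f hx)]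
    · rw [M.proj_of_mem_ne hx h, N.proj_of_mem_ne (lin_mem f hx) h, map_zero]

/-- A criterion for a family of subspaces to be a grading. -/
theorem isInternal_of_proj {V : Type u} [AddCommGroup V] [Module k V] (ℳ : ℤ → Submodule k V)
    (p : ℤ → V →ₗ[k] V) (h₁ : ∀ i, ∀ m ∈ ℳ i, p i m = m)
    (h₂ : ∀ i j, i ≠ j → ∀ m ∈ ℳ i, p j m = 0)
    (h₃ : ∀ m : V, ∃ s : Finset ℤ, ∑ i ∈ s, p i m = m) (h₄ : ∀ i m, p i m ∈ ℳ i) :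
    DirectSum.IsInternal ℳ := by
  rw [DirectSum.isInternal_submodule_iff_iSupIndep_and_iSup_eq_top]
  refine ⟨fun i => ?_, ?_⟩
  · rw [Submodule.disjoint_def]
    intro x hx hx'
    have : ⨆ (j) (_ : j ≠ i), ℳ j ≤ LinearMap.ker (p i) :=
      iSup₂_le fun j hj m hm => h₂ j i hj m hm
    rw [← h₁ i x hx]
    exact this hx'
  · rw [eq_top_iff]
    intro m _
    obtain ⟨s, hs⟩ := h₃ m
    rw [← hs]
    exact Submodule.sum_mem _ fun i _ => Submodule.mem_iSup_of_mem i (h₄ i m)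

/-- A submodule is graded (homogeneous) if it contains the homogeneous components of
its elements. -/
def IsGraded (M : GrMod 𝒜) (p : Submodule A M) : Prop :=
  ∀ (i : ℤ) (m : M), m ∈ p → M.proj i m ∈ p

/-- A graded submodule as a graded module. -/
def sub (M : GrMod 𝒜) (p : Submodule A M) (hp : M.IsGraded p) : GrMod 𝒜 where
  carrier := p
  deg i := (M.deg i).comap (p.subtype.restrictScalars k)
  isInternal := by
    refine isInternal_of_proj _
      (fun i => (M.proj i).restrict (p := p.restrictScalars k) (q := p.restrictScalars k)
        (fun m hm => hp i m hm)) ?_ ?_ ?_ ?_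
    · intro i m hm
      exact Subtype.ext (M.proj_of_mem hm)
    · intro i j hij m hm
      exact Subtype.ext (M.proj_of_mem_ne hm hij)
    · rintro ⟨m, hm⟩
      obtain ⟨s, hs⟩ := M.exists_sum_proj m
      refine ⟨s, Subtype.ext ?_⟩
      refine Eq.trans ?_ hs
      exact map_sum p.subtype _ _
    · intro i m
      exact M.proj_mem i m
  smul_mem i j a m ha hm := M.smul_mem i j a m ha hm

/-- The inclusion of a graded submodule. -/
def subι (M : GrMod 𝒜) (p : Submodule A M) (hp : M.IsGraded p) : M.sub p hp ⟶ M :=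
  homMk p.subtype fun _ _ h => h

/-- A morphism with image in a graded submodule, as a morphism to this submodule. -/
def subLift {M P : GrMod 𝒜} (p : Submodule A M) (hp : M.IsGraded p) (g : P ⟶ M)
    (hg : ∀ x, lin g x ∈ p) : P ⟶ M.sub p hp :=
  homMk ((lin g).codRestrict p hg) fun _ _ hx => lin_mem g hx

@[simp] theorem subLift_comp_subι {M P : GrMod 𝒜} (p : Submodule A M) (hp : M.IsGraded p)
    (g : P ⟶ M) (hg : ∀ x, lin g x ∈ p) : subLift p hp g hg ≫ M.subι p hp = g := rfl

/-- The quotient by a graded submodule. -/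
def quot (M : GrMod 𝒜) (p : Submodule A M) (hp : M.IsGraded p) : GrMod 𝒜 where
  carrier := M ⧸ p
  deg i := (M.deg i).map (p.mkQ.restrictScalars k)
  isInternal := by
    refine isInternal_of_proj _
      (fun i => (p.restrictScalars k).mapQ (p.restrictScalars k) (M.proj i)
        (fun m hm => hp i m hm)) ?_ ?_ ?_ ?_
    · rintro i _ ⟨m, hm, rfl⟩
      exact congrArg p.mkQ (M.proj_of_mem hm)
    · rintro i j hij _ ⟨m, hm, rfl⟩
      exact congrArg p.mkQ (M.proj_of_mem_ne hm hij)
    · intro m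
      obtain ⟨m, rfl⟩ := p.mkQ_surjective m
      obtain ⟨s, hs⟩ := M.exists_sum_proj m
      refine ⟨s, ?_⟩
      conv_rhs => rw [← hs]
      exact (map_sum p.mkQ _ _).symm
    · intro i m
      obtain ⟨m, rfl⟩ := p.mkQ_surjective m
      exact ⟨_, M.proj_mem i m, rfl⟩
  smul_mem := by
    rintro i j a _ ha ⟨m, hm, rfl⟩
    exact ⟨a • m, M.smul_mem i j a m ha hm, rfl⟩

/-- The projection onto the quotient by a graded submodule. -/
def quotπ (M : GrMod 𝒜) (p : Submodule A M) (hp : M.IsGraded p) : M ⟶ M.quot p hp :=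
  homMk p.mkQ fun _ m h => ⟨m, h, rfl⟩

/-- The direct sum of two graded modules. -/
def prod (M N : GrMod 𝒜) : GrMod 𝒜 where
  carrier := M × N
  deg i := (M.deg i).prod (N.deg i)
  isInternal := by
    classical
    refine isInternal_of_proj _ (fun i => (M.proj i).prodMap (N.proj i)) ?_ ?_ ?_ ?_
    · rintro i ⟨m, n⟩ ⟨hm, hn⟩
      exact Prod.ext (M.proj_of_mem hm) (N.proj_of_mem hn)
    · rintro i j hij ⟨m, n⟩ ⟨hm, hn⟩
      exact Prod.ext (M.proj_of_mem_ne hm hij) (N.proj_of_mem_ne hn hij)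
    · rintro ⟨m, n⟩
      let _ := M.isInternal.chooseDecomposition
      let _ := N.isInternal.chooseDecomposition
      refine ⟨(DirectSum.decompose M.deg m).support ∪ (DirectSum.decompose N.deg n).support, ?_⟩
      have key : ∀ (P : GrMod 𝒜) (x : P) (s t : Finset ℤ), s ⊆ t → ∑ i ∈ s, P.proj i x = x →
          ∑ i ∈ t, P.proj i x = x := by
        intro P x s t hst hs
        have : ∀ i ∉ s, P.proj i x = 0 := by
          intro i hi
          rw [← hs, map_sum]
          exact Finset.sum_eq_zero fun j hj =>
            P.proj_of_mem_ne (P.proj_mem j x) fun h => hi (h ▸ hj)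
        rw [← Finset.sum_subset hst fun i _ hi => this i hi, hs]
      refine Prod.ext ?_ ?_
      · rw [Prod.fst_sum]
        exact key M m _ _ Finset.subset_union_left (DirectSum.sum_support_decompose M.deg m)
      · rw [Prod.snd_sum]
        exact key N n _ _ Finset.subset_union_right (DirectSum.sum_support_decompose N.deg n)
    · rintro i ⟨m, n⟩
      exact ⟨M.proj_mem i m, N.proj_mem i n⟩
  smul_mem := by
    rintro i j a ⟨m, n⟩ ha ⟨hm, hn⟩
    exact ⟨M.smul_mem i j a m ha hm, N.smul_mem i j a n ha hn⟩

/-- The zero graded module. -/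
def zero (𝒜 : ℤ → Submodule k A) : GrMod 𝒜 where
  carrier := PUnit
  deg _ := ⊤
  isInternal := isInternal_of_proj _ (fun _ => 0) (fun _ _ _ => rfl) (fun _ _ _ _ _ => rfl)
    (fun _ => ⟨∅, rfl⟩) fun _ _ => trivial
  smul_mem _ _ _ _ _ _ := trivial

theorem isZero_zero (𝒜 : ℤ → Submodule k A) : IsZero (zero 𝒜) := by
  rw [IsZero.iff_id_eq_zero]
  exact hom_ext' fun _ => rfl

instance : HasZeroObject (GrMod 𝒜) := ⟨⟨zero 𝒜, isZero_zero 𝒜⟩⟩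

/-- The biproduct cone on the direct sum. -/
def bicone (M N : GrMod 𝒜) : BinaryBicone M N where
  pt := M.prod N
  fst := homMk (LinearMap.fst A M N) fun _ _ h => h.1
  snd := homMk (LinearMap.snd A M N) fun _ _ h => h.2
  inl := homMk (LinearMap.inl A M N) fun i _ h => ⟨h, (N.deg i).zero_mem⟩
  inr := homMk (LinearMap.inr A M N) fun i _ h => ⟨(M.deg i).zero_mem, h⟩
  inl_fst := rfl
  inl_snd := rfl
  inr_fst := rfl
  inr_snd := rfl

instance : HasBinaryBiproducts (GrMod 𝒜) where
  has_binary_biproduct M N := hasBinaryBiproduct_of_total (bicone M N)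
    (hom_ext' fun m => by
      obtain ⟨x, y⟩ := m
      exact Prod.ext (add_zero x) (zero_add y))

instance : HasFiniteProducts (GrMod 𝒜) :=
  haveI : HasBinaryProducts (GrMod 𝒜) := inferInstance
  hasFiniteProducts_of_has_binary_and_terminal

theorem isGraded_ker {M N : GrMod 𝒜} (f : M ⟶ N) : M.IsGraded (LinearMap.ker (lin f)) :=
  fun i m hm => by
    rw [LinearMap.mem_ker] at hm ⊢
    rw [lin_proj, hm, map_zero]

theorem isGraded_range {M N : GrMod 𝒜} (f : M ⟶ N) : N.IsGraded (LinearMap.range (lin f)) := by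
  rintro i _ ⟨m, rfl⟩
  exact ⟨M.proj i m, lin_proj f i m⟩

/-- The kernel of a morphism of graded modules. -/
def ker {M N : GrMod 𝒜} (f : M ⟶ N) : GrMod 𝒜 := M.sub _ (isGraded_ker f)

/-- The cokernel of a morphism of graded modules. -/
def coker {M N : GrMod 𝒜} (f : M ⟶ N) : GrMod 𝒜 := N.quot _ (isGraded_range f)

theorem mono_of_injective {M N : GrMod 𝒜} (f : M ⟶ N) (hf : Function.Injective (lin f)) :
    Mono f where
  right_cancellation g h e := hom_ext' fun m => hf <| by
    rw [← lin_comp, ← lin_comp, e]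

instance {M : GrMod 𝒜} (p : Submodule A M) (hp : M.IsGraded p) : Mono (M.subι p hp) :=
  mono_of_injective _ Subtype.val_injective

theorem epi_of_surjective {M N : GrMod 𝒜} (f : M ⟶ N) (hf : Function.Surjective (lin f)) :
    Epi f where
  left_cancellation g h e := hom_ext' fun n => by
    obtain ⟨m, rfl⟩ := hf n
    rw [← lin_comp, ← lin_comp, e]

theorem injective_of_mono {M N : GrMod 𝒜} (f : M ⟶ N) [Mono f] :
    Function.Injective (lin f) := by
  have h : M.subι _ (isGraded_ker f) = 0 := by
    rw [← cancel_mono f, zero_comp]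
    exact hom_ext' fun m => m.2
  rw [← LinearMap.ker_eq_bot, eq_bot_iff]
  intro m hm
  exact congrArg (fun g => lin g (⟨m, hm⟩ : LinearMap.ker (lin f))) h

theorem surjective_of_epi {M N : GrMod 𝒜} (f : M ⟶ N) [Epi f] :
    Function.Surjective (lin f) := by
  have h : N.quotπ _ (isGraded_range f) = 0 := by
    rw [← cancel_epi f, comp_zero]
    exact hom_ext' fun m => (Submodule.Quotient.mk_eq_zero _).2 ⟨m, rfl⟩
  intro n
  exact (Submodule.Quotient.mk_eq_zero (LinearMap.range (lin f))).1
    (congrArg (fun g => lin g n) h)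

/-- A morphism into `N` with image in the image of the injective morphism `f` lifts. -/
noncomputable def liftInj {M N P : GrMod 𝒜} (f : M ⟶ N) (hf : Function.Injective (lin f))
    (g : P ⟶ N) (hg : ∀ x, lin g x ∈ LinearMap.range (lin f)) : P ⟶ M :=
  homMk ((LinearEquiv.ofInjective (lin f) hf).symm.toLinearMap ∘ₗ
      (lin g).codRestrict (LinearMap.range (lin f)) hg) fun i x hx => by
    set y := ((LinearEquiv.ofInjective (lin f) hf).symm.toLinearMap ∘ₗ
      (lin g).codRestrict (LinearMap.range (lin f)) hg) x with hy
    have hfy : lin f y = lin g x :=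
      congrArg Subtype.val ((LinearEquiv.ofInjective (lin f) hf).apply_symm_apply
        ((lin g).codRestrict (LinearMap.range (lin f)) hg x))
    have : M.proj i y = y := hf (by rw [lin_proj, hfy, N.proj_of_mem (lin_mem g hx)])
    rw [← this]
    exact M.proj_mem i y

theorem liftInj_comp {M N P : GrMod 𝒜} (f : M ⟶ N) (hf : Function.Injective (lin f))
    (g : P ⟶ N) (hg : ∀ x, lin g x ∈ LinearMap.range (lin f)) : liftInj f hf g hg ≫ f = g :=
  hom_ext' fun x => congrArg Subtype.val ((LinearEquiv.ofInjective (lin f) hf).apply_symm_apply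
    ((lin g).codRestrict (LinearMap.range (lin f)) hg x))

/-- A morphism out of `M` that kills the kernel of the surjective morphism `f` descends. -/
noncomputable def descSurj {M N P : GrMod 𝒜} (f : M ⟶ N) (hf : Function.Surjective (lin f))
    (g : M ⟶ P) (hg : LinearMap.ker (lin f) ≤ LinearMap.ker (lin g)) : N ⟶ P :=
  homMk ((LinearMap.ker (lin f)).liftQ (lin g) hg ∘ₗ
      ((lin f).quotKerEquivOfSurjective hf).symm.toLinearMap) fun i n hn => by
    obtain ⟨m, rfl⟩ := hf n
    have h : lin f (M.proj i m) = lin f m := by rw [lin_proj, N.proj_of_mem hn]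
    rw [← h]
    have : ((lin f).quotKerEquivOfSurjective hf).symm (lin f (M.proj i m)) =
        Submodule.Quotient.mk (M.proj i m) := by
      rw [LinearEquiv.symm_apply_eq]
      rfl
    rw [LinearMap.comp_apply, LinearEquiv.coe_coe, this]
    exact lin_mem g (M.proj_mem i m)

theorem comp_descSurj {M N P : GrMod 𝒜} (f : M ⟶ N) (hf : Function.Surjective (lin f))
    (g : M ⟶ P) (hg : LinearMap.ker (lin f) ≤ LinearMap.ker (lin g)) :
    f ≫ descSurj f hf g hg = g :=
  hom_ext' fun m => by
    have : ((lin f).quotKerEquivOfSurjective hf).symm (lin f m) = Submodule.Quotient.mk m := by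
      rw [LinearEquiv.symm_apply_eq]
      rfl
    change (LinearMap.ker (lin f)).liftQ (lin g) hg
      (((lin f).quotKerEquivOfSurjective hf).symm (lin f m)) = _
    rw [this]
    rfl

/-- An injective morphism is a kernel of any morphism that has its image as kernel. -/
noncomputable def isKernel {M N P : GrMod 𝒜} (f : M ⟶ N) (g : N ⟶ P)
    (hf : Function.Injective (lin f)) (w : f ≫ g = 0)
    (h : ∀ n, lin g n = 0 → n ∈ LinearMap.range (lin f)) : IsLimit (KernelFork.ofι f w) :=
  haveI := mono_of_injective f hf
  KernelFork.IsLimit.ofι' f w fun l hl =>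
    ⟨liftInj f hf l fun x => h _ (by rw [← lin_comp, hl, lin_zero]), liftInj_comp _ _ _ _⟩

/-- A surjective morphism is a cokernel of any morphism that has its kernel as image. -/
noncomputable def isCokernel {M N P : GrMod 𝒜} (f : M ⟶ N) (g : N ⟶ P)
    (hg : Function.Surjective (lin g)) (w : f ≫ g = 0)
    (h : ∀ n, lin g n = 0 → n ∈ LinearMap.range (lin f)) : IsColimit (CokernelCofork.ofπ g w) :=
  haveI := epi_of_surjective g hg
  CokernelCofork.IsColimit.ofπ' g w fun l hl =>
    ⟨descSurj g hg l fun n hn => by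
      obtain ⟨m, rfl⟩ := h n hn
      rw [LinearMap.mem_ker, ← lin_comp, hl, lin_zero], comp_descSurj _ _ _ _⟩

theorem kerι_comp {M N : GrMod 𝒜} (f : M ⟶ N) : M.subι _ (isGraded_ker f) ≫ f = 0 :=
  hom_ext' fun m => m.2

theorem comp_cokerπ {M N : GrMod 𝒜} (f : M ⟶ N) : f ≫ N.quotπ _ (isGraded_range f) = 0 :=
  hom_ext' fun m => (Submodule.Quotient.mk_eq_zero _).2 ⟨m, rfl⟩

/-- The inclusion of `ker f` is a kernel of `f`. -/
noncomputable def kerIsKernel {M N : GrMod 𝒜} (f : M ⟶ N) :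
    IsLimit (KernelFork.ofι _ (kerι_comp f)) :=
  isKernel _ f Subtype.val_injective _ fun n hn => ⟨⟨n, hn⟩, rfl⟩

/-- The projection onto `coker f` is a cokernel of `f`. -/
noncomputable def cokerIsCokernel {M N : GrMod 𝒜} (f : M ⟶ N) :
    IsColimit (CokernelCofork.ofπ _ (comp_cokerπ f)) :=
  isCokernel f (N.quotπ _ (isGraded_range f)) (Submodule.mkQ_surjective _) _ fun _ hn => (Submodule.Quotient.mk_eq_zero _).1 hn

instance : HasKernels (GrMod 𝒜) where
  has_limit f := ⟨⟨⟨_, kerIsKernel f⟩⟩⟩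

instance : HasCokernels (GrMod 𝒜) where
  has_colimit f := ⟨⟨⟨_, cokerIsCokernel f⟩⟩⟩

instance : IsNormalMonoCategory (GrMod 𝒜) where
  normalMonoOfMono f _ := ⟨⟨_, _, comp_cokerπ f, isKernel f _ (injective_of_mono f) _
    fun _ hn => (Submodule.Quotient.mk_eq_zero _).1 hn⟩⟩

instance : IsNormalEpiCategory (GrMod 𝒜) where
  normalEpiOfEpi f _ := ⟨⟨_, _, kerι_comp f, isCokernel _ f (surjective_of_epi f) _
    fun n hn => ⟨⟨n, hn⟩, rfl⟩⟩⟩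

/-- Graded modules form an abelian category. -/
instance : Abelian (GrMod 𝒜) where

/-- Direct limits of finite-dimensional graded modules, that is, graded modules that are the union
of their finite-dimensional graded submodules (any two of these lie in a third one, their sum). -/
def Fdim (𝒜 : ℤ → Submodule k A) : ObjectProperty (GrMod 𝒜) := fun M =>
  ∀ m : M, ∃ N : Submodule A M, M.IsGraded N ∧ FiniteDimensional k N ∧ m ∈ N

theorem finite_of_le {M : GrMod 𝒜} {p q : Submodule A M} (h : p ≤ q) [FiniteDimensional k q] :
    FiniteDimensional k p :=
  FiniteDimensional.of_injective ((Submodule.inclusion h).restrictScalars k)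
    (Submodule.inclusion_injective h)

theorem finite_map {M N : GrMod 𝒜} (f : M ⟶ N) (p : Submodule A M) [FiniteDimensional k p] :
    FiniteDimensional k (p.map (lin f)) := by
  have : FiniteDimensional k (p.restrictScalars k) := ‹_›
  exact inferInstanceAs
    (FiniteDimensional k ((p.restrictScalars k).map ((lin f).restrictScalars k)))

theorem finite_sup {M : GrMod 𝒜} (p q : Submodule A M) [hp : FiniteDimensional k p]
    [hq : FiniteDimensional k q] : FiniteDimensional k (p ⊔ q : Submodule A M) := by
  have : FiniteDimensional k (p.restrictScalars k) := hp
  have : FiniteDimensional k (q.restrictScalars k) := hq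
  have e : (p ⊔ q).restrictScalars k = p.restrictScalars k ⊔ q.restrictScalars k := by
    ext x
    simp [Submodule.mem_sup]
  have h : FiniteDimensional k (p.restrictScalars k ⊔ q.restrictScalars k : Submodule k M) :=
    inferInstance
  rw [← e] at h
  exact h

theorem isGraded_map {M N : GrMod 𝒜} (f : M ⟶ N) {p : Submodule A M} (hp : M.IsGraded p) :
    N.IsGraded (p.map (lin f)) := by
  rintro i _ ⟨m, hm, rfl⟩
  exact ⟨M.proj i m, hp i m hm, lin_proj f i m⟩

theorem isGraded_sup {M : GrMod 𝒜} {p q : Submodule A M} (hp : M.IsGraded p)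
    (hq : M.IsGraded q) : M.IsGraded (p ⊔ q) := by
  intro i m hm
  obtain ⟨x, hx, y, hy, rfl⟩ := Submodule.mem_sup.1 hm
  rw [map_add]
  exact Submodule.add_mem_sup (hp i x hx) (hq i y hy)

theorem finite_span {M : GrMod 𝒜} (F : Submodule k M) [hF : FiniteDimensional k F]
    (h : ∀ x ∈ F, FiniteDimensional k (Submodule.span A {x})) :
    FiniteDimensional k (Submodule.span A (F : Set M)) := by
  obtain ⟨s, hs⟩ := (Submodule.fg_iff_finiteDimensional F).2 hF
  have e : Submodule.span A (F : Set M) = Submodule.span A (s : Set M) := by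
    rw [← hs, Submodule.span_span_of_tower]
  rw [e]
  have hs' : ∀ x ∈ s, FiniteDimensional k (Submodule.span A {x}) := fun x hx =>
    h x (hs ▸ Submodule.subset_span hx)
  clear e hs h hF
  classical
  induction s using Finset.induction_on with
  | empty =>
    rw [Finset.coe_empty, Submodule.span_empty]
    infer_instance
  | insert a s _ ih =>
    rw [Finset.coe_insert, Submodule.span_insert]
    have := ih fun x hx => hs' x (Finset.mem_insert_of_mem hx)
    have := hs' a (Finset.mem_insert_self a s)
    exact finite_sup _ _

/-- For a finitely generated algebra, `Fdim` is closed under extensions. -/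
theorem finite_of_extension [Algebra.FiniteType k A] {M P : GrMod 𝒜} (g : M ⟶ P)
    (h₁ : ∀ x : M, lin g x = 0 → FiniteDimensional k (Submodule.span A {x}))
    (m : M) (h₂ : FiniteDimensional k (Submodule.span A {lin g m})) :
    FiniteDimensional k (Submodule.span A {m}) := by
  classical
  obtain ⟨S, hS⟩ := (inferInstance : Algebra.FiniteType k A).out
  let g' : M →ₗ[k] P := (lin g).restrictScalars k
  let Q : Submodule k P := (Submodule.span A {lin g m}).restrictScalars k
  have hQ : FiniteDimensional k Q := h₂
  have hQmap : ∀ x ∈ Q, ∃ y : M, g' y = x := by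
    intro x hx
    obtain ⟨a, rfl⟩ := Submodule.mem_span_singleton.1 hx
    exact ⟨a • m, map_smul (lin g) a m⟩
  obtain ⟨t, ht⟩ := (Submodule.fg_iff_finiteDimensional Q).2 hQ
  have htQ : ∀ x ∈ t, x ∈ Q := fun x hx => ht ▸ Submodule.subset_span hx
  choose! l hl using fun x (hx : x ∈ t) => hQmap x (htQ x hx)
  let U : Submodule k M := Submodule.span k (insert m (t.image l) : Finset M)
  have hUfin : FiniteDimensional k U := FiniteDimensional.span_finset k _
  have hmU : m ∈ U := Submodule.subset_span (by simp)
  have hUQ : U ≤ Q.comap g' := by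
    refine Submodule.span_le.2 fun x hx => ?_
    rw [Finset.coe_insert, Finset.coe_image] at hx
    rcases hx with rfl | ⟨y, hy, rfl⟩
    · exact Submodule.mem_span_singleton_self _
    · change g' (l y) ∈ Q
      rw [hl y hy]
      exact htQ y hy
  have hQU : Q ≤ U.map g' := by
    rw [← ht]
    refine Submodule.span_le.2 fun x hx => ⟨l x, Submodule.subset_span ?_, hl x hx⟩
    rw [Finset.coe_insert, Finset.coe_image]
    exact Or.inr ⟨x, hx, rfl⟩
  let mulL : A → M →ₗ[k] M := fun a => Algebra.lsmul k k M a
  let U' : Submodule k M := U ⊔ ⨆ a : S, U.map (mulL a)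
  have hU'fin : FiniteDimensional k U' := inferInstance
  have hU'Q : U' ≤ Q.comap g' := by
    refine sup_le hUQ (iSup_le fun a => ?_)
    rintro _ ⟨u, hu, rfl⟩
    change lin g ((a : A) • u) ∈ Submodule.span A {lin g m}
    rw [map_smul]
    exact Submodule.smul_mem _ _ (hUQ hu)
  let F : Submodule k M := U' ⊓ LinearMap.ker g'
  have hFfin : FiniteDimensional k F := Submodule.finiteDimensional_inf_left _ _
  have hF : FiniteDimensional k (Submodule.span A (F : Set M)) :=
    finite_span F fun x hx => h₁ x hx.2
  let T : Submodule k M := U ⊔ (Submodule.span A (F : Set M)).restrictScalars k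
  have hU'T : U' ≤ T := by
    intro x hx
    obtain ⟨u, hu, hux⟩ := hQU (hU'Q hx)
    have : x - u ∈ F := ⟨Submodule.sub_mem _ hx (Submodule.mem_sup_left hu), by
      change g' (x - u) = 0
      rw [map_sub, hux, sub_self]⟩
    rw [← add_sub_cancel u x]
    exact Submodule.add_mem_sup hu (Submodule.subset_span this)
  have hT : ∀ a : A, ∀ x ∈ T, a • x ∈ T := by
    intro a
    have ha : a ∈ Algebra.adjoin k (S : Set A) := hS ▸ Algebra.mem_top
    induction ha using Algebra.adjoin_induction with
    | mem a ha =>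
      intro x hx
      obtain ⟨u, hu, y, hy, rfl⟩ := Submodule.mem_sup.1 hx
      rw [smul_add]
      refine T.add_mem (hU'T (Submodule.mem_sup_right
        (Submodule.mem_iSup_of_mem ⟨a, ha⟩ ⟨u, hu, rfl⟩))) (Submodule.mem_sup_right ?_)
      exact Submodule.smul_mem (Submodule.span A (F : Set M)) a hy
    | algebraMap c =>
      intro x hx
      rw [algebraMap_smul]
      exact T.smul_mem c hx
    | add a b _ _ ha hb =>
      intro x hx
      rw [add_smul]
      exact T.add_mem (ha x hx) (hb x hx)
    | mul a b _ _ ha hb =>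
      intro x hx
      rw [mul_smul]
      exact ha _ (hb x hx)
  have hTfin : FiniteDimensional k T := by
    have : FiniteDimensional k ((Submodule.span A (F : Set M)).restrictScalars k) := hF
    infer_instance
  have hle : (Submodule.span A {m}).restrictScalars k ≤ T := by
    intro x hx
    obtain ⟨a, rfl⟩ := Submodule.mem_span_singleton.1 hx
    exact hT a m (Submodule.mem_sup_left hmU)
  exact Submodule.finiteDimensional_of_le hle

section Serre

variable [GradedAlgebra 𝒜]

theorem isGraded_span_singleton {M : GrMod 𝒜} {i : ℤ} {m : M} (hm : m ∈ M.deg i) :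
    M.IsGraded (Submodule.span A {m}) := by
  intro j x hx
  obtain ⟨a, rfl⟩ := Submodule.mem_span_singleton.1 hx
  induction a using DirectSum.Decomposition.inductionOn 𝒜 with
  | zero => simp
  | @homogeneous l a =>
    have h := M.smul_mem l i a m a.2 hm
    by_cases hj : l + i = j
    · subst hj
      rwa [M.proj_of_mem h]
    · rw [M.proj_of_mem_ne h hj]
      exact Submodule.zero_mem _
  | add a b ha hb =>
    rw [add_smul, map_add]
    exact Submodule.add_mem _
      (ha (Submodule.smul_mem _ _ (Submodule.mem_span_singleton_self m)))
      (hb (Submodule.smul_mem _ _ (Submodule.mem_span_singleton_self m)))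

theorem fdim_iff (M : GrMod 𝒜) :
    Fdim 𝒜 M ↔ ∀ m : M, FiniteDimensional k (Submodule.span A {m}) := by
  constructor
  · intro h m
    obtain ⟨N, -, hN, hm⟩ := h m
    exact finite_of_le ((Submodule.span_singleton_le_iff_mem m N).2 hm)
  · intro h m
    induction m using M.induction_on with
    | h0 => exact ⟨⊥, fun i m hm => by rw [(Submodule.mem_bot A).1 hm, map_zero]; exact zero_mem _,
        inferInstance, zero_mem _⟩
    | hadd x y hx hy =>
      obtain ⟨p, hp, _, hxp⟩ := hx
      obtain ⟨q, hq, _, hyq⟩ := hy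
      exact ⟨p ⊔ q, isGraded_sup hp hq, finite_sup p q, Submodule.add_mem_sup hxp hyq⟩
    | hdeg i x hx =>
      exact ⟨_, isGraded_span_singleton hx, h x, Submodule.mem_span_singleton_self x⟩

variable (𝒜) in
/-- `Fdim` is a Serre subcategory of the category of graded modules. -/
instance [Algebra.FiniteType k A] : (Fdim 𝒜).IsSerreClass where
  exists_zero := ⟨zero 𝒜, isZero_zero 𝒜, fun _ => ⟨⊥, fun _ _ _ => rfl, inferInstance, rfl⟩⟩
  prop_of_mono {X Y} f _ hY := by
    rw [fdim_iff] at hY ⊢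
    intro x
    have := hY (lin f x)
    have hle : ∀ y ∈ Submodule.span A {x}, lin f y ∈ Submodule.span A {lin f x} := by
      intro y hy
      obtain ⟨a, rfl⟩ := Submodule.mem_span_singleton.1 hy
      rw [map_smul]
      exact Submodule.smul_mem _ _ (Submodule.mem_span_singleton_self _)
    exact FiniteDimensional.of_injective (((lin f).restrict hle).restrictScalars k)
      fun a b hab => Subtype.ext (injective_of_mono f (congrArg Subtype.val hab))
  prop_of_epi {X Y} f _ hX := by
    intro y
    obtain ⟨x, rfl⟩ := surjective_of_epi f y
    obtain ⟨N, hN, _, hx⟩ := hX x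
    exact ⟨_, isGraded_map f hN, finite_map f N, ⟨x, hx, rfl⟩⟩
  prop_X₂_of_shortExact {S} hS h₁ h₃ := by
    rw [fdim_iff] at h₁ h₃ ⊢
    intro m
    refine finite_of_extension S.g (fun x hx => ?_) m (h₃ _)
    have := hS.mono_f
    let e := hS.fIsKernel.lift (KernelFork.ofι _ (kerι_comp S.g))
    have he : e ≫ S.f = subι _ _ (isGraded_ker S.g) :=
      hS.fIsKernel.fac (KernelFork.ofι _ (kerι_comp S.g)) WalkingParallelPair.zero
    let y : S.X₁ := lin e (⟨x, hx⟩ : LinearMap.ker (lin S.g))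
    have hy : lin S.f y = x :=
      congrArg (fun φ => lin φ (⟨x, hx⟩ : LinearMap.ker (lin S.g))) he
    have := h₁ y
    have hf := finite_map S.f (Submodule.span A {y})
    rwa [Submodule.map_span, Set.image_singleton, hy] at hf

section Quotient

variable [Algebra.FiniteType k A]

theorem isoModSerre_iff {M N : GrMod 𝒜} (f : M ⟶ N) :
    (Fdim 𝒜).isoModSerre f ↔ Fdim 𝒜 (ker f) ∧ Fdim 𝒜 (coker f) :=
  and_congr
    ((Fdim 𝒜).prop_iff_of_iso ((kernelIsKernel f).conePointUniqueUpToIso (kerIsKernel f)))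
    ((Fdim 𝒜).prop_iff_of_iso
      ((cokernelIsCokernel f).coconePointUniqueUpToIso (cokerIsCokernel f)))

/-- Every morphism `M → N` of the localized category is given by a graded submodule
of `M × N`. -/
theorem exists_graph {M N : GrMod 𝒜}
    (φ : (Fdim 𝒜).isoModSerre.Q.obj M ⟶ (Fdim 𝒜).isoModSerre.Q.obj N) :
    ∃ (p : Submodule A (M.prod N)) (hp : (M.prod N).IsGraded p),
      IsIso ((Fdim 𝒜).isoModSerre.Q.map ((M.prod N).subι p hp ≫ (bicone M N).fst)) ∧
      (Fdim 𝒜).isoModSerre.Q.map ((M.prod N).subι p hp ≫ (bicone M N).fst) ≫ φ =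
        (Fdim 𝒜).isoModSerre.Q.map ((M.prod N).subι p hp ≫ (bicone M N).snd) := by
  let W := (Fdim 𝒜).isoModSerre
  obtain ⟨ψ, hψ⟩ := Localization.exists_rightFraction W.Q W φ
  have hs := ψ.hs
  let g : ψ.X' ⟶ M.prod N := homMk ((lin ψ.s).prod (lin ψ.f)) fun i m hm =>
    ⟨lin_mem ψ.s hm, lin_mem ψ.f hm⟩
  let p := LinearMap.range (lin g)
  have hp : (M.prod N).IsGraded p := isGraded_range g
  let e : ψ.X' ⟶ (M.prod N).sub p hp := homMk (lin g).rangeRestrict fun i m hm => lin_mem g hm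
  have he : Function.Surjective (lin e) := LinearMap.surjective_rangeRestrict _
  let s' := (M.prod N).subι p hp ≫ (bicone M N).fst
  have hes : e ≫ s' = ψ.s := rfl
  have hef : e ≫ (M.prod N).subι p hp ≫ (bicone M N).snd = ψ.f := rfl
  have hs' : W s' := by
    replace hs := (isoModSerre_iff _).1 hs
    refine (isoModSerre_iff _).2 ?_
    refine ⟨?_, ?_⟩
    · let r : ker ψ.s ⟶ ker s' := homMk ((lin e).restrict fun x hx => hx) fun i m hm =>
        lin_mem e hm
      have hr : Function.Surjective (lin r) := by
        rintro ⟨y, hy⟩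
        obtain ⟨x, rfl⟩ := he y
        exact ⟨⟨x, hy⟩, rfl⟩
      have := epi_of_surjective r hr
      exact (Fdim 𝒜).prop_of_epi r hs.1
    · have hle : LinearMap.range (lin ψ.s) ≤ LinearMap.range (lin s') := by
        rintro _ ⟨x, rfl⟩
        exact ⟨lin e x, rfl⟩
      let r : coker ψ.s ⟶ coker s' := homMk
        (Submodule.mapQ _ _ LinearMap.id hle) (by
          rintro i _ ⟨m, hm, rfl⟩
          exact ⟨m, hm, rfl⟩)
      have hr : Function.Surjective (lin r) := by
        intro y
        obtain ⟨x, rfl⟩ := Submodule.mkQ_surjective _ y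
        exact ⟨Submodule.mkQ _ x, rfl⟩
      have := epi_of_surjective r hr
      exact (Fdim 𝒜).prop_of_epi r hs.2
  have i₁ : IsIso (W.Q.map s') := Localization.inverts W.Q W s' hs'
  have i₂ : IsIso (W.Q.map (e ≫ s')) := Localization.inverts W.Q W _ ψ.hs
  have i₃ : IsIso (W.Q.map e) := by
    rw [Functor.map_comp] at i₂
    exact IsIso.of_isIso_comp_right _ (W.Q.map s')
  refine ⟨p, hp, i₁, ?_⟩
  rw [← cancel_epi (W.Q.map e), ← Functor.map_comp_assoc, ← Functor.map_comp]
  change W.Q.map ψ.s ≫ φ = W.Q.map ψ.f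
  rw [hψ]
  exact ψ.map_s_comp_map _ _

variable (𝒜) in
theorem locallySmall_localization : LocallySmall.{u} (Fdim 𝒜).isoModSerre.Localization where
  hom_small X Y := by
    obtain ⟨M, rfl⟩ : ∃ M, (Fdim 𝒜).isoModSerre.Q.obj M = X :=
      (Localization.Construction.objEquiv _).surjective X
    obtain ⟨N, rfl⟩ : ∃ N, (Fdim 𝒜).isoModSerre.Q.obj N = Y :=
      (Localization.Construction.objEquiv _).surjective Y
    choose p hp hi h using fun φ => exists_graph (M := M) (N := N) φ
    refine small_of_injective (β := Submodule A (M.prod N)) (f := p) fun φ φ' e => ?_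
    have key : ∀ (q : Submodule A (M.prod N)) (hq : (M.prod N).IsGraded q) (_ : q = p φ),
        (Fdim 𝒜).isoModSerre.Q.map ((M.prod N).subι q hq ≫ (bicone M N).fst) ≫ φ =
        (Fdim 𝒜).isoModSerre.Q.map ((M.prod N).subι q hq ≫ (bicone M N).snd) := by
      rintro q hq rfl
      exact h φ
    have := hi φ'
    rw [← cancel_epi ((Fdim 𝒜).isoModSerre.Q.map
      ((M.prod N).subι (p φ') (hp φ') ≫ (bicone M N).fst)), key _ _ e.symm, h φ']

/-- The localization of the category of graded modules at the morphisms with kernel and cokernel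
in `Fdim` has a model whose morphisms form types in the universe of the modules. -/
noncomputable instance : (Fdim 𝒜).isoModSerre.HasLocalization :=
  haveI := locallySmall_localization 𝒜
  MorphismProperty.hasLocalizationOfLocallySmall.{u} _ (Fdim 𝒜).isoModSerre.Q

end Quotient

end Serre

end GrMod

/-- The quotient category `QGr = Gr / Fdim`, that is, the localization of the category of graded
modules at the morphisms whose kernel and cokernel belong to the Serre subcategory `Fdim`. -/
abbrev QGr (𝒜 : ℤ → Submodule k A) [GradedAlgebra 𝒜] [Algebra.FiniteType k A] : Type (u + 1) :=
  (GrMod.Fdim 𝒜).isoModSerre.Localization'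

/-- The quotient functor `π* : Gr ⥤ QGr`. -/
noncomputable abbrev QGr.quotientFunctor (𝒜 : ℤ → Submodule k A) [GradedAlgebra 𝒜]
    [Algebra.FiniteType k A] : GrMod 𝒜 ⥤ QGr 𝒜 :=
  (GrMod.Fdim 𝒜).isoModSerre.Q'

/-- The algebra `A` as a graded left module over itself. -/
def GrMod.self (𝒜 : ℤ → Submodule k A) [GradedAlgebra 𝒜] : GrMod 𝒜 where
  carrier := A
  deg := 𝒜
  isInternal := DirectSum.Decomposition.isInternal 𝒜
  smul_mem _ _ _ _ ha hm := SetLike.mul_mem_graded ha hm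

end GradedModules

/-- An object `X` is finitely generated if, whenever `X` is the sum (least upper bound) of a directed
family of subobjects, it is equal to a member of the family. -/
def IsFinitelyGeneratedObject {C : Type*} [Category* C] (X : C) : Prop :=
  ∀ D : Set (Subobject X), D.Nonempty → DirectedOn (· ≤ ·) D → IsLUB D ⊤ → ⊤ ∈ D

section FreeAlgebra

variable (k : Type u) [Field k] (n : ℕ)

/-- The free algebra `k⟨x₀, …, xₙ⟩`. -/
abbrev FreeAlg : Type u := FreeAlgebra k (Fin (n + 1))

namespace FreeAlg

instance : Algebra.FiniteType k (FreeAlg k n) := by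
  classical
  refine ⟨⟨Finset.univ.image (FreeAlgebra.ι k), ?_⟩⟩
  rw [Finset.coe_image, Finset.coe_univ, Set.image_univ]
  exact FreeAlgebra.adjoin_range_ι k _

/-- The homogeneous elements of degree `i`: linear combinations of words of length `i`
in `x₀, …, xₙ`. -/
def grading (i : ℤ) : Submodule k (FreeAlg k n) :=
  Submodule.span k {r | ∃ w : List (Fin (n + 1)), (w.length : ℤ) = i ∧
    (w.map (FreeAlgebra.ι k)).prod = r}

theorem word_mem (w : List (Fin (n + 1))) :
    (w.map (FreeAlgebra.ι k)).prod ∈ grading k n w.length :=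
  Submodule.subset_span ⟨w, rfl, rfl⟩

instance : SetLike.GradedMonoid (grading k n) where
  one_mem := Submodule.subset_span ⟨[], rfl, rfl⟩
  mul_mem i j a b ha hb := by
    have : grading k n i * grading k n j ≤ grading k n (i + j) := by
      rw [grading, grading, Submodule.span_mul_span]
      refine Submodule.span_le.2 ?_
      rintro _ ⟨_, ⟨v, rfl, rfl⟩, _, ⟨w, rfl, rfl⟩, rfl⟩
      refine Submodule.subset_span ⟨v ++ w, by simp, by simp⟩
    exact this (Submodule.mul_mem_mul ha hb)

/-- The decomposition of an element of the free algebra into homogeneous components. -/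
noncomputable def decomposeHom : FreeAlg k n →ₐ[k] DirectSum ℤ fun i => grading k n i :=
  FreeAlgebra.lift k fun x => DirectSum.of (fun i => grading k n i) 1
    ⟨FreeAlgebra.ι k x, Submodule.subset_span ⟨[x], by simp, by simp⟩⟩

theorem decomposeHom_word (w : List (Fin (n + 1))) :
    decomposeHom k n (w.map (FreeAlgebra.ι k)).prod =
      DirectSum.of (fun i => grading k n i) w.length ⟨_, word_mem k n w⟩ := by
  induction w with
  | nil =>
    simp only [List.map_nil, List.prod_nil, map_one]
    rfl
  | cons x w ih =>
    have h : decomposeHom k n (FreeAlgebra.ι k x) = DirectSum.of (fun i => grading k n i) 1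
        ⟨FreeAlgebra.ι k x, Submodule.subset_span ⟨[x], by simp, by simp⟩⟩ :=
      FreeAlgebra.lift_ι_apply _ _
    refine (map_mul (decomposeHom k n) (FreeAlgebra.ι k x) _).trans ?_
    refine (congrArg₂ (· * ·) h ih).trans ?_
    refine (DirectSum.of_mul_of _ _).trans ?_
    exact DirectSum.of_eq_of_gradedMonoid_eq (Sigma.subtype_ext
      (show (1 : ℤ) + w.length = ((w.length + 1 : ℕ) : ℤ) by push_cast; ring) rfl)

noncomputable instance : GradedAlgebra (grading k n) :=
  GradedAlgebra.ofAlgHom (grading k n) (decomposeHom k n)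
    (by
      ext x
      simp [decomposeHom])
    (by
      rintro i ⟨x, hx⟩
      induction hx using Submodule.span_induction with
      | mem x h =>
        obtain ⟨w, rfl, rfl⟩ := h
        exact decomposeHom_word k n w
      | zero =>
        rw [map_zero]
        exact (map_zero (DirectSum.of (fun i => grading k n i) i)).symm
      | add x y hx hy ihx ihy =>
        rw [map_add, ihx, ihy, ← map_add]
        rfl
      | smul c x hx ih =>
        rw [map_smul, ih]
        exact (map_smul (DirectSum.lof k ℤ (fun i => grading k n i) i) c ⟨x, hx⟩).symm)

theorem grading_eq_bot {i : ℤ} (hi : i < 0) : grading k n i = ⊥ := by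
  rw [grading, Submodule.span_eq_bot]
  rintro _ ⟨w, hw, -⟩
  omega

/-- The free algebra as an object of the category of its graded left modules. -/
noncomputable abbrev regular : GrMod (grading k n) := GrMod.self (grading k n)

/-- The subspace `⨁_{j ≥ i} R_j` of the free algebra `R`. -/
noncomputable def geSubspace (i : ℕ) : Submodule k (regular k n) :=
  ⨆ (j : ℤ) (_ : (i : ℤ) ≤ j), (regular k n).deg j

theorem mem_geSubspace {i : ℕ} {j : ℤ} (h : (i : ℤ) ≤ j) {x : regular k n}
    (hx : x ∈ (regular k n).deg j) : x ∈ geSubspace k n i :=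
  Submodule.mem_iSup_of_mem j (Submodule.mem_iSup_of_mem h hx)

theorem smul_mem_geSubspace (i : ℕ) (a : FreeAlg k n) (r : regular k n)
    (hr : r ∈ geSubspace k n i) : a • r ∈ geSubspace k n i := by
  induction a using DirectSum.Decomposition.inductionOn (grading k n) with
  | zero =>
    rw [zero_smul]
    exact Submodule.zero_mem _
  | add a b ha hb =>
    rw [add_smul]
    exact Submodule.add_mem _ ha hb
  | @homogeneous l a =>
    have h : geSubspace k n i ≤
        (geSubspace k n i).comap (Algebra.lsmul k k (regular k n) (a : FreeAlg k n)) := by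
      refine iSup₂_le fun j hj x hx => ?_
      rw [Submodule.mem_comap, Algebra.lsmul_coe]
      rcases lt_or_ge l 0 with hl | hl
      · have h0 : (a : FreeAlg k n) = 0 :=
          (Submodule.mem_bot k).1 ((grading_eq_bot k n hl).le a.2)
        have h1 : (a : FreeAlg k n) • x = 0 := by rw [h0, zero_smul]
        exact h1.symm.subst (motive := fun y => y ∈ geSubspace k n i) (Submodule.zero_mem _)
      · exact mem_geSubspace k n (by omega) ((regular k n).smul_mem l j a x a.2 hx)
    exact h hr

/-- The graded left ideal `R_{≥ i} = ⨁_{j ≥ i} R_j` of the free algebra `R`. -/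
noncomputable def geIdeal (i : ℕ) : Submodule (FreeAlg k n) (regular k n) where
  __ := geSubspace k n i
  smul_mem' a r hr := smul_mem_geSubspace k n i a r hr

theorem isGraded_geIdeal (i : ℕ) : (regular k n).IsGraded (geIdeal k n i) := by
  intro l m hm
  have h : geSubspace k n i ≤ (geSubspace k n i).comap ((regular k n).proj l) := by
    refine iSup₂_le fun j hj x hx => ?_
    rw [Submodule.mem_comap]
    by_cases h : j = l
    · subst h
      rw [(regular k n).proj_of_mem hx]
      exact mem_geSubspace k n hj hx
    · rw [(regular k n).proj_of_mem_ne hx h]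
      exact Submodule.zero_mem _
  exact h hm

/-- `R_{≥ i}` as a graded left `R`-module. -/
noncomputable abbrev ge (i : ℕ) : GrMod (grading k n) :=
  (regular k n).sub (geIdeal k n i) (isGraded_geIdeal k n i)

/-- The inclusion `R_{≥ i} → R`. -/
noncomputable abbrev geι (i : ℕ) : ge k n i ⟶ regular k n :=
  (regular k n).subι (geIdeal k n i) (isGraded_geIdeal k n i)

theorem geIdeal_le {i j : ℕ} (h : i ≤ j) : geIdeal k n j ≤ geIdeal k n i := by
  have : geSubspace k n j ≤ geSubspace k n i :=
    iSup₂_le fun l hl x hx => mem_geSubspace k n (by omega) hx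
  exact fun x hx => this hx

/-- The inclusion `R_{≥ j} → R_{≥ i}` for `i ≤ j`. -/
noncomputable def geIncl {i j : ℕ} (h : i ≤ j) : ge k n j ⟶ ge k n i :=
  GrMod.subLift _ _ (geι k n j) fun x => geIdeal_le k n h x.2

@[simp] theorem geIncl_comp_geι {i j : ℕ} (h : i ≤ j) :
    geIncl k n h ≫ geι k n i = geι k n j :=
  GrMod.subLift_comp_subι _ _ _ _

/-- Morphisms to `R` map `R_{≥ j}` to itself. -/
theorem mem_geIdeal {j : ℕ} (g : ge k n j ⟶ regular k n) (x : ge k n j) :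
    GrMod.lin g x ∈ geIdeal k n j := by
  induction x using (ge k n j).induction_on with
  | h0 =>
    rw [map_zero]
    exact Submodule.zero_mem _
  | hadd x y hx hy =>
    rw [map_add]
    exact Submodule.add_mem _ hx hy
  | hdeg l x hx =>
    by_cases hl : (j : ℤ) ≤ l
    · exact mem_geSubspace k n hl (GrMod.lin_mem g hx)
    · have h0 : x = 0 := by
        have hle : geSubspace k n j ≤ LinearMap.ker ((regular k n).proj l) :=
          iSup₂_le fun l' hl' y hy => (regular k n).proj_of_mem_ne hy (by omega)
        have h1 : (regular k n).proj l x.1 = 0 := hle x.2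
        exact Subtype.ext (((regular k n).proj_of_mem hx).symm.trans h1)
      rw [h0, map_zero]
      exact Submodule.zero_mem _

/-- The restriction `f ↦ f|_{R_{≥ j}}` of an endomorphism of `R_{≥ i}`, for `i ≤ j`. -/
noncomputable def restrict {i j : ℕ} (h : i ≤ j) (f : ge k n i ⟶ ge k n i) :
    ge k n j ⟶ ge k n j :=
  GrMod.subLift _ _ (geIncl k n h ≫ f ≫ geι k n i) (mem_geIdeal k n _)

theorem restrict_comp_geι {i j : ℕ} (h : i ≤ j) (f : ge k n i ⟶ ge k n i) :
    restrict k n h f ≫ geι k n j = geIncl k n h ≫ f ≫ geι k n i :=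
  GrMod.subLift_comp_subι _ _ _ _

theorem restrict_comp_geIncl {i j : ℕ} (h : i ≤ j) (f : ge k n i ⟶ ge k n i) :
    restrict k n h f ≫ geIncl k n h = geIncl k n h ≫ f := by
  rw [← cancel_mono (geι k n i), Category.assoc, geIncl_comp_geι, restrict_comp_geι,
    Category.assoc]

/-- Restriction of endomorphisms as a homomorphism of `k`-algebras. -/
noncomputable def restrictHom (i j : ℕ) (h : i ≤ j) : End (ge k n i) →ₐ[k] End (ge k n j) :=
  AlgHom.ofLinearMap
    { toFun := fun f => restrict k n h f
      map_add' := fun f g => by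
        rw [← cancel_mono (geι k n j)]
        exact (restrict_comp_geι k n h (f + g)).trans (by
          rw [Preadditive.add_comp, Preadditive.add_comp, Preadditive.comp_add,
            restrict_comp_geι, restrict_comp_geι])
      map_smul' := fun c f => by
        rw [← cancel_mono (geι k n j)]
        exact (restrict_comp_geι k n h (c • f)).trans (by
          rw [RingHom.id_apply, Linear.smul_comp, Linear.smul_comp, Linear.comp_smul,
            restrict_comp_geι]) }
    (by
      rw [← cancel_mono (geι k n j)]
      exact (restrict_comp_geι k n h (𝟙 _)).trans
        (by rw [Category.id_comp, geIncl_comp_geι]; exact (Category.id_comp _).symm))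
    fun f g => by
      rw [← cancel_mono (geι k n j)]
      refine (restrict_comp_geι k n h (g ≫ f)).trans (Eq.symm ?_)
      change (restrict k n h g ≫ restrict k n h f) ≫ geι k n j = _
      rw [Category.assoc, restrict_comp_geι, ← Category.assoc, restrict_comp_geIncl,
        Category.assoc, Category.assoc]

theorem restrictHom_apply {i j : ℕ} (h : i ≤ j) (f : End (ge k n i)) :
    restrictHom k n i j h f = restrict k n h f := rfl

instance : DirectedSystem (fun i => End (ge k n i)) (fun _ _ h => restrictHom k n _ _ h) where
  map_self i f := by
    change restrict k n le_rfl f = f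
    have h : geIncl k n (le_refl i) = 𝟙 _ := by
      rw [← cancel_mono (geι k n i), geIncl_comp_geι, Category.id_comp]
    rw [← Category.comp_id (restrict k n le_rfl f), ← h, restrict_comp_geIncl, h,
      Category.id_comp]
  map_map l j i h₁ h₂ f := by
    change restrict k n h₂ (restrict k n h₁ f) = restrict k n (h₁.trans h₂) f
    have h : geIncl k n h₂ ≫ geIncl k n h₁ = geIncl k n (h₁.trans h₂) := by
      rw [← cancel_mono (geι k n i), Category.assoc, geIncl_comp_geι, geIncl_comp_geι,
        geIncl_comp_geι]
    rw [← cancel_mono (geι k n l), restrict_comp_geι, restrict_comp_geι, restrict_comp_geι, ← h,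
      Category.assoc]

/-- The direct limit of the algebras `End(R_{≥ i})` along the restriction maps. -/
abbrev EndLimit : Type u := DirectLimit (fun i => End (ge k n i)) (restrictHom k n)

noncomputable instance : Algebra k (EndLimit k n) :=
  Algebra.ofModule (fun c x y => smul_mul_assoc c x y) (fun c x y => mul_smul_comm c x y)

/-- The structure sheaf `𝒪 = π* R`. -/
noncomputable abbrev structureSheaf : QGr (grading k n) :=
  (QGr.quotientFunctor (grading k n)).obj (regular k n)

end FreeAlg

end FreeAlgebra

/-! The proof rests on two facts. `R_{≥ i}` is free on the finitely many words of length `i`, all of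
degree `i`; and a graded module lies in `Fdim` exactly when each element is killed by all
sufficiently long words (`fdim_iff_isTorsionElement`). So a graded map `R_{≥ i} → N` lifts along any
map to `N` with cokernel in `Fdim`, once it is restricted to a smaller `R_{≥ j}`: only finitely many
values must be lifted (`exists_ge_lift`). Likewise, a map with torsion values vanishes on some `R_{≥
j}` (`exists_geIncl_comp_eq_zero`).

As `R / R_{≥ i}` is finite-dimensional, `π* R_{≥ i} ≅ 𝒪`. Every morphism `𝒪 → π* N` is therefore
represented by some `R_{≥ i} → N` (`exists_ge_hom`), and `Hom(𝒪, π* N)` is the direct limit of the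
groups `Hom(R_{≥ i}, N)`. For `N = R` this computes `End 𝒪`, because graded maps `R_{≥ i} → R` land
in `R_{≥ i}`. Lifting along maps with torsion cokernel gives projectivity. The generator property
holds because a homogeneous element of degree `i ≥ 0` is a value of a map from `R_{≥ i}`, and long
words carry every homogeneous element into nonnegative degree.

The remaining claims are Morita theory. The image of `R^(I)` in `QGr R` is a copower of `𝒪`,
preserved by `Hom(𝒪, -)` because `R_{≥ i}` is finitely generated (`isSpanningCopower_directSum`). In
an abelian category, a projective separator with such copowers is a finitely generated object and
induces an equivalence with modules; both follow by presenting objects through copowers. -/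

/-! ### Morita theory for a projective separator in an abelian category. -/

section Progenerator

universe v w

variable {C : Type w} [Category.{v} C] [Abelian C] {G : C}

/-- A family of morphisms `i a : G ⟶ P` that extend jointly along arbitrary families of morphisms
out of `G`, and that span `Hom(G, P)` over `End G`. If `G` is a separator, this exhibits `P` as
a coproduct of copies of `G` that is preserved by `Hom(G, -)`. -/
structure IsSpanningCopower {I : Type v} {P : C} (i : I → (G ⟶ P)) : Prop where
  exists_desc : ∀ {Y : C} (ψ : I → (G ⟶ Y)), ∃ χ : P ⟶ Y, ∀ a, i a ≫ χ = ψ a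
  span_eq_top : Submodule.span (End G)ᵐᵒᵖ (Set.range i) = ⊤

namespace IsSpanningCopower

variable {I : Type v} {P : C} {i : I → (G ⟶ P)}

/-- A submodule of `Hom(G, Y)` that contains all `i a ≫ χ` contains all `φ ≫ χ`. -/
theorem comp_mem (h : IsSpanningCopower i) {Y : C} (χ : P ⟶ Y)
    (S : Submodule (End G)ᵐᵒᵖ (G ⟶ Y)) (hS : ∀ a, i a ≫ χ ∈ S) (φ : G ⟶ P) : φ ≫ χ ∈ S := by
  have hle : Submodule.span (End G)ᵐᵒᵖ (Set.range i) ≤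
      S.comap ((preadditiveCoyonedaObj G).map χ).hom := by
    refine Submodule.span_le.2 ?_
    rintro _ ⟨a, rfl⟩
    exact hS a
  exact hle (h.span_eq_top ▸ Submodule.mem_top)

/-- Extending the Kronecker delta family along `i` gives coordinate projections `p a : P ⟶ G`;
composing a linear relation with `p a` isolates the coefficient of `i a`. -/
theorem linearIndependent (h : IsSpanningCopower i) :
    LinearIndependent (End G)ᵐᵒᵖ i := by
  classical
  choose p hp using fun a : I => h.exists_desc (fun b => if b = a then 𝟙 G else 0)
  refine linearIndependent_iff'.2 fun s g hg a ha => ?_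
  have h1 := congrArg (fun φ => φ ≫ p a) hg
  simp only [Preadditive.sum_comp, zero_comp] at h1
  rw [Finset.sum_eq_single a] at h1
  · have h2 : (g a).unop ≫ i a ≫ p a = 0 := by
      rw [← Category.assoc]
      exact h1
    rw [hp a a, if_pos rfl, Category.comp_id] at h2
    exact MulOpposite.unop_injective h2
  · intro b _ hb
    change ((g b).unop ≫ i b) ≫ p a = 0
    rw [Category.assoc, hp a b, if_neg hb, comp_zero]
  · exact fun h => absurd ha h

/-- The basis of `Hom(G, P)` over `End G`. -/
noncomputable def basis (h : IsSpanningCopower i) : Module.Basis I (End G)ᵐᵒᵖ (G ⟶ P) :=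
  .mk h.linearIndependent h.span_eq_top.ge

theorem basis_apply (h : IsSpanningCopower i) (a : I) : h.basis a = i a :=
  Module.Basis.mk_apply _ _ a

end IsSpanningCopower

/-- The copower indexed by all morphisms `G ⟶ X` maps onto `X` by `ψ`. A linear map `h` prescribes a
morphism `χ` out of this copower, and `χ` descends along `ψ` to a morphism that induces `h`. -/
theorem full_preadditiveCoyonedaObj (hG : IsSeparator G)
    (hP : ∀ I : Type v, ∃ (P : C) (i : I → (G ⟶ P)), IsSpanningCopower i) :
    (preadditiveCoyonedaObj G : C ⥤ ModuleCat (End G)ᵐᵒᵖ).Full where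
  map_surjective {X Y} h := by
    rw [Preadditive.isSeparator_iff] at hG
    obtain ⟨P, i, hi⟩ := hP (G ⟶ X)
    obtain ⟨ψ, hψ⟩ := hi.exists_desc (fun φ : G ⟶ X => φ)
    obtain ⟨χ, hχ⟩ := hi.exists_desc (fun φ : G ⟶ X => (h.hom φ : G ⟶ Y))
    -- Both sides are linear in `φ`, so it suffices to compare them on the basis `i`; this is where
    -- preservation of the copower by `Hom(G, -)` enters.
    have key : ∀ φ : G ⟶ P, φ ≫ χ = h.hom (φ ≫ ψ) := by
      have : ((preadditiveCoyonedaObj G).map χ).hom =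
          h.hom ∘ₗ ((preadditiveCoyonedaObj G).map ψ).hom := by
        refine hi.basis.ext fun a => ?_
        rw [hi.basis_apply]
        exact (hχ a).trans (congrArg h.hom (hψ a).symm)
      exact fun φ => LinearMap.congr_fun this φ
    have : Epi ψ := by
      rw [Preadditive.epi_iff_cancel_zero]
      refine fun Z t ht => hG t fun φ => ?_
      rw [← hψ φ, Category.assoc, ht, comp_zero]
    have hker : kernel.ι ψ ≫ χ = 0 := hG _ fun α => by
      rw [← Category.assoc, key, Category.assoc, kernel.condition, comp_zero]
      exact map_zero h.hom
    refine ⟨Abelian.epiDesc ψ χ hker, ?_⟩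
    ext φ
    change φ ≫ Abelian.epiDesc ψ χ hker = h.hom φ
    rw [← hχ φ]
    conv_lhs => rw [← hψ φ]
    rw [Category.assoc, Abelian.comp_epiDesc]

/-- A presentation of `V` by free modules lifts to a morphism `θ : P' ⟶ P` of copowers. As `Hom(G,
-)` is exact, it sends `cokernel θ` to the presented module. -/
theorem essSurj_preadditiveCoyonedaObj [Projective G]
    (hP : ∀ I : Type v, ∃ (P : C) (i : I → (G ⟶ P)), IsSpanningCopower i) :
    (preadditiveCoyonedaObj G : C ⥤ ModuleCat.{v} (End G)ᵐᵒᵖ).EssSurj where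
  mem_essImage V := by
    obtain ⟨P, i, hi⟩ := hP V
    let p : (G ⟶ P) →ₗ[(End G)ᵐᵒᵖ] V := hi.basis.constr ℕ id
    have hp : ∀ v, p (i v) = v := fun v => by
      rw [← hi.basis_apply]
      exact hi.basis.constr_basis ℕ id v
    have hpsurj : Function.Surjective p := fun v => ⟨i v, hp v⟩
    obtain ⟨P', i', hi'⟩ := hP (LinearMap.ker p)
    obtain ⟨θ, hθ⟩ := hi'.exists_desc (fun κ : LinearMap.ker p => (κ : G ⟶ P))
    let q : (G ⟶ P) →ₗ[(End G)ᵐᵒᵖ] (G ⟶ cokernel θ) :=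
      ((preadditiveCoyonedaObj G).map (cokernel.π θ)).hom
    have hq : Function.Surjective q := fun φ =>
      ⟨Projective.factorThru φ (cokernel.π θ), Projective.factorThru_comp _ _⟩
    -- A `φ` killed by `cokernel.π θ` factors through the image of `θ`, hence by projectivity of `G`
    -- through `θ` itself; then `comp_mem` reduces membership in `ker p` to the generators of
    -- `Hom(G, P')`.
    have hker : LinearMap.ker q = LinearMap.ker p := by
      ext φ
      constructor
      · intro (hφ : φ ≫ cokernel.π θ = 0)
        let φ' := kernel.lift _ φ hφ
        have : φ = Projective.factorThru φ' (Abelian.factorThruImage θ) ≫ θ := by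
          have h := congrArg (· ≫ Abelian.image.ι θ)
            (Projective.factorThru_comp φ' (Abelian.factorThruImage θ))
          simp only [Category.assoc, Abelian.image.fac] at h
          exact (h.trans (kernel.lift_ι _ φ hφ)).symm
        rw [this]
        exact hi'.comp_mem θ (LinearMap.ker p) (fun κ => by rw [hθ]; exact κ.2) _
      · intro hφ
        change φ ≫ cokernel.π θ = 0
        rw [← show i' ⟨φ, hφ⟩ ≫ θ = φ from hθ ⟨φ, hφ⟩, Category.assoc, cokernel.condition,
          comp_zero]
    let e : (G ⟶ cokernel θ) ≃ₗ[(End G)ᵐᵒᵖ] V :=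
      (q.quotKerEquivOfSurjective hq).symm ≪≫ₗ Submodule.quotEquivOfEq _ _ hker ≪≫ₗ
        p.quotKerEquivOfSurjective hpsurj
    exact ⟨cokernel θ, ⟨e.toModuleIso⟩⟩

/-- A projective separator whose copowers exist and are preserved by `Hom(G, -)` induces
an equivalence with the category of right modules over its endomorphism ring. -/
theorem isEquivalence_preadditiveCoyonedaObj [Projective G] (hG : IsSeparator G)
    (hP : ∀ I : Type v, ∃ (P : C) (i : I → (G ⟶ P)), IsSpanningCopower i) :
    (preadditiveCoyonedaObj G : C ⥤ ModuleCat.{v} (End G)ᵐᵒᵖ).IsEquivalence where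
  faithful := (isSeparator_iff_faithful_preadditiveCoyonedaObj G).1 hG
  full := full_preadditiveCoyonedaObj hG hP
  essSurj := essSurj_preadditiveCoyonedaObj hP

/-- The endomorphisms that factor through some member of `D` form a right ideal `J`, closed under
sums because `D` is directed. The copower indexed by `J` maps onto the supremum of `D`, which is
`G`; projectivity then puts `𝟙 G` in `J`, so that one member of `D` is everything. -/
theorem isFinitelyGeneratedObject_of_isSeparator [Projective G] (hG : IsSeparator G)
    (hP : ∀ I : Type v, ∃ (P : C) (i : I → (G ⟶ P)), IsSpanningCopower i) :
    IsFinitelyGeneratedObject G := by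
  intro D hne hdir hlub
  rw [Preadditive.isSeparator_iff] at hG
  let J : Submodule (End G)ᵐᵒᵖ (G ⟶ G) :=
    { carrier := {g | ∃ d ∈ D, d.Factors g}
      zero_mem' := by
        obtain ⟨d, hd⟩ := hne
        exact ⟨d, hd, Subobject.factors_zero⟩
      add_mem' := by
        rintro f g ⟨d, hd, hf⟩ ⟨d', hd', hg⟩
        obtain ⟨d'', hd'', h, h'⟩ := hdir d hd d' hd'
        exact ⟨d'', hd'', Subobject.factors_add f g
          (Subobject.factors_of_le f h hf) (Subobject.factors_of_le g h' hg)⟩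
      smul_mem' := by
        rintro s g ⟨d, hd, hg⟩
        exact ⟨d, hd, Subobject.factors_of_factors_right s.unop hg⟩ }
  obtain ⟨P, i, hi⟩ := hP J
  obtain ⟨θ, hθ⟩ := hi.exists_desc (fun g : J => (g : G ⟶ G))
  -- This subobject is the image of `θ`. It contains each `d ∈ D` because `G` is a separator and
  -- every composite `G ⟶ d ⟶ G` belongs to `J`.
  have hub : kernelSubobject (cokernel.π θ) ∈ upperBounds D := by
    intro d hd
    refine Subobject.le_of_comm (factorThruKernelSubobject _ d.arrow (hG _ fun α => ?_))
      (factorThruKernelSubobject_comp_arrow _ _ _)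
    have hα : α ≫ d.arrow ∈ J := ⟨d, hd, Subobject.factors_comp_arrow α⟩
    rw [← Category.assoc, ← show i ⟨_, hα⟩ ≫ θ = α ≫ d.arrow from hθ ⟨_, hα⟩,
      Category.assoc, cokernel.condition, comp_zero]
  have htop : kernelSubobject (cokernel.π θ) = ⊤ := top_le_iff.1 (hlub.2 hub)
  have : Epi θ := by
    refine Preadditive.epi_of_cokernel_zero ?_
    have := (Subobject.isIso_iff_mk_eq_top (kernel.ι (cokernel.π θ))).2 htop
    rw [← cancel_epi (kernel.ι (cokernel.π θ)), kernel.condition, comp_zero]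
  obtain ⟨d, hd, h1⟩ : 𝟙 G ∈ J := by
    rw [← Projective.factorThru_comp (𝟙 G) θ]
    exact hi.comp_mem θ J (fun g => by rw [hθ]; exact g.2) _
  have hd1 : d = ⊤ := by
    rw [eq_top_iff]
    refine Subobject.le_of_comm ((⊤ : Subobject G).arrow ≫ d.factorThru _ h1) ?_
    rw [Category.assoc, Subobject.factorThru_arrow, Category.comp_id]
  exact hd1 ▸ hd

end Progenerator

/-! ### Direct sums of graded modules. -/

namespace GrMod

section DirectSum

variable {k A : Type u} [Field k] [Ring A] [Algebra k A] {𝒜 : ℤ → Submodule k A}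

theorem sum_proj_of_subset (M : GrMod 𝒜) {m : M} {s t : Finset ℤ}
    (hs : ∑ i ∈ s, M.proj i m = m) (hst : s ⊆ t) : ∑ i ∈ t, M.proj i m = m := by
  have : ∀ i ∉ s, M.proj i m = 0 := by
    intro i hi
    rw [← hs, map_sum]
    exact Finset.sum_eq_zero fun j hj => M.proj_of_mem_ne (M.proj_mem j m) fun h => hi (h ▸ hj)
  rw [← Finset.sum_subset hst fun i _ hi => this i hi, hs]

theorem lin_sum {M N : GrMod 𝒜} {J : Type*} (s : Finset J) (f : J → (M ⟶ N)) (m : M) :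
    lin (∑ a ∈ s, f a) m = ∑ a ∈ s, lin (f a) m := by
  classical
  induction s using Finset.induction_on with
  | empty => simp
  | insert a s ha ih => rw [Finset.sum_insert ha, Finset.sum_insert ha, lin_add, ih]

variable {I : Type u} (M : I → GrMod 𝒜)

/-- The direct sum of a family of graded modules. -/
noncomputable def directSum : GrMod 𝒜 where
  carrier := Π₀ a, M a
  deg i :=
    { carrier := {x | ∀ a, x a ∈ (M a).deg i}
      add_mem' := fun hx hy a => Submodule.add_mem _ (hx a) (hy a)
      zero_mem' := fun a => Submodule.zero_mem _
      smul_mem' := fun c _ hx a => Submodule.smul_mem _ c (hx a) }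
  isInternal := by
    classical
    refine isInternal_of_proj _
      (fun i => DFinsupp.mapRange.linearMap fun a => (M a).proj i) ?_ ?_ ?_ ?_
    · intro i x hx
      ext a
      exact (M a).proj_of_mem (hx a)
    · intro i j hij x hx
      ext a
      exact (M a).proj_of_mem_ne (hx a) hij
    · intro x
      choose s hs using fun a => (M a).exists_sum_proj (x a)
      -- Only finitely many components of `x` are nonzero, so the degrees occurring in them form a
      -- finite set.
      refine ⟨x.support.biUnion s, ?_⟩
      ext a
      rw [DFinsupp.finsetSum_apply]
      by_cases ha : x a = 0
      · rw [ha]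
        refine Finset.sum_eq_zero fun i _ => ?_
        change (M a).proj i (x a) = 0
        rw [ha, map_zero]
      · exact (M a).sum_proj_of_subset (hs a)
          (Finset.subset_biUnion_of_mem s (DFinsupp.mem_support_iff.2 ha))
    · intro i x a
      exact (M a).proj_mem i (x a)
  smul_mem i j r x hr hx a := (M a).smul_mem i j r (x a) hr (hx a)

open Classical in
/-- The inclusion of a summand into a direct sum. -/
noncomputable def directSumι (a : I) : M a ⟶ directSum M :=
  homMk (N := directSum M) (DFinsupp.lsingle (M := fun a => M a) a) fun i m hm b => by
    change (DFinsupp.single a m : Π₀ a, M a) b ∈ (M b).deg i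
    rw [DFinsupp.single_apply]
    split_ifs with h
    · subst h
      exact hm
    · exact Submodule.zero_mem _

/-- The projection of a direct sum onto a summand. -/
noncomputable def directSumπ (a : I) : directSum M ⟶ M a :=
  homMk (M := directSum M) (DFinsupp.lapply (M := fun a => M a) a) fun _ _ hm => hm a

variable {M}

open Classical in
/-- The morphism out of a direct sum given by morphisms out of the summands. -/
noncomputable def directSumDesc {N : GrMod 𝒜} (f : ∀ a, M a ⟶ N) : directSum M ⟶ N :=
  homMk (M := directSum M) (DFinsupp.lsum ℕ (M := fun a => M a) fun a => lin (f a))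
    fun i x hx => by
      have h : ∀ y : Π₀ a, M a, (∀ a, y a ∈ (M a).deg i) →
          DFinsupp.lsum ℕ (M := fun a => M a) (fun a => lin (f a)) y ∈ N.deg i := by
        intro y hy
        rw [DFinsupp.lsum_apply_apply, DFinsupp.sumAddHom_apply]
        exact Submodule.sum_mem _ fun a _ => lin_mem (f a) (hy a)
      exact h x hx

@[simp] theorem directSumι_desc {N : GrMod 𝒜} (f : ∀ a, M a ⟶ N) (a : I) :
    directSumι M a ≫ directSumDesc f = f a := by
  classical
  refine hom_ext' fun m => ?_
  exact DFinsupp.lsum_single (M := fun a => M a) (R := A) (S := ℕ) (fun a => lin (f a)) a m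

/-- The morphism of direct sums given by morphisms of the summands. -/
noncomputable def directSumMap {N : I → GrMod 𝒜} (f : ∀ a, M a ⟶ N a) :
    directSum M ⟶ directSum N :=
  homMk (M := directSum M) (N := directSum N)
    (DFinsupp.mapRange.linearMap (β₁ := fun a => M a) (β₂ := fun a => N a) fun a => lin (f a))
    fun _ _ hx a => lin_mem (f a) (hx a)

theorem directSumι_map {N : I → GrMod 𝒜} (f : ∀ a, M a ⟶ N a) (a : I) :
    directSumι M a ≫ directSumMap f = f a ≫ directSumι N a := by
  classical
  refine hom_ext' fun m => ?_
  exact DFinsupp.mapRange_single (f := fun a => lin (f a)) (hf := fun a => map_zero (lin (f a)))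
    (i := a) (b := m)

theorem directSumMap_injective {N : I → GrMod 𝒜} (f : ∀ a, M a ⟶ N a)
    (hf : ∀ a, Function.Injective (lin (f a))) : Function.Injective (lin (directSumMap f)) :=
  (DFinsupp.mapRange_injective (fun a => lin (f a)) fun a => map_zero (lin (f a))).2 hf

theorem exists_finset_directSumπ (x : directSum M) :
    ∃ T : Finset I, ∀ a ∉ T, lin (directSumπ M a) x = 0 := by
  classical
  exact ⟨DFinsupp.support (show Π₀ a, M a from x), fun a ha => DFinsupp.notMem_support_iff.1 ha⟩

/-- An element of a direct sum is the sum of its components. -/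
theorem sum_directSumι_directSumπ (x : directSum M) {T : Finset I}
    (hT : ∀ a ∉ T, lin (directSumπ M a) x = 0) :
    ∑ a ∈ T, lin (directSumι M a) (lin (directSumπ M a) x) = x := by
  classical
  refine DFinsupp.ext fun b => ?_
  refine (DFinsupp.finsetSum_apply T _ b).trans ?_
  have h : ∀ a, (show Π₀ a, M a from lin (directSumι M a) (lin (directSumπ M a) x)) b =
      if h : a = b then (show Π₀ a, M a from x) b else 0 := by
    intro a
    refine (DFinsupp.single_apply (β := fun a => M a) (i := a) (i' := b)
      (b := lin (directSumπ M a) x)).trans ?_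
    split_ifs with hab
    · subst hab
      rfl
    · rfl
  refine (Finset.sum_congr rfl fun a _ => h a).trans ?_
  by_cases hb : b ∈ T
  · simp [hb]
  · simp only [dite_eq_ite, Finset.sum_ite_eq', hb, if_false]
    exact (hT b hb).symm

end DirectSum

end GrMod

/-! ### Words and torsion elements. -/

namespace FreeAlg

variable (k : Type u) [Field k] (n : ℕ)

/-- The element of the free algebra given by a word. -/
noncomputable def word (w : List (Fin (n + 1))) : FreeAlg k n := (w.map (FreeAlgebra.ι k)).prod

theorem word_append (v w : List (Fin (n + 1))) :
    word k n (v ++ w) = word k n v * word k n w := by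
  simp [word]

theorem word_nil : word k n [] = 1 := rfl

theorem grading_eq_span (i : ℤ) :
    grading k n i = Submodule.span k {r | ∃ w, (w.length : ℤ) = i ∧ word k n w = r} := rfl

/-- Makes the words a `k`-basis of the free algebra, so that linear maps may be prescribed on them.
-/
theorem basisFreeMonoid_eq_word (w : List (Fin (n + 1))) :
    FreeAlgebra.basisFreeMonoid k (Fin (n + 1)) (FreeMonoid.ofList w) = word k n w := by
  simp [FreeAlgebra.basisFreeMonoid, FreeAlgebra.equivMonoidAlgebraFreeMonoid, word,
    MonoidAlgebra.lift_single, FreeMonoid.lift_ofList]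

theorem span_word : Submodule.span k (Set.range (word k n)) = ⊤ := by
  rw [← (FreeAlgebra.basisFreeMonoid k (Fin (n + 1))).span_eq]
  congr 1
  ext r
  constructor
  · rintro ⟨w, rfl⟩
    exact ⟨FreeMonoid.ofList w, basisFreeMonoid_eq_word k n w⟩
  · rintro ⟨w, rfl⟩
    exact ⟨w.toList, (basisFreeMonoid_eq_word k n w.toList).symm⟩

variable {k n}

theorem word_smul_mem_deg {M : GrMod (grading k n)} {d : ℤ} {m : M} (hm : m ∈ M.deg d)
    (w : List (Fin (n + 1))) : word k n w • m ∈ M.deg (w.length + d) :=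
  M.smul_mem _ _ _ _ (word_mem k n w) hm

/-- An element is torsion if it is killed by all sufficiently long words. -/
def IsTorsionElement {M : GrMod (grading k n)} (m : M) : Prop :=
  ∃ l : ℕ, ∀ w : List (Fin (n + 1)), l ≤ w.length → word k n w • m = 0

theorem IsTorsionElement.add {M : GrMod (grading k n)} {x y : M} (hx : IsTorsionElement x)
    (hy : IsTorsionElement y) : IsTorsionElement (x + y) := by
  obtain ⟨l, hl⟩ := hx
  obtain ⟨l', hl'⟩ := hy
  refine ⟨max l l', fun w hw => ?_⟩
  rw [smul_add, hl w (le_trans (le_max_left _ _) hw), hl' w (le_trans (le_max_right _ _) hw),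
    add_zero]

theorem finite_lists_length_eq (l : ℕ) : Set.Finite {w : List (Fin (n + 1)) | w.length = l} :=
  List.finite_length_eq _ l

/-- There are finitely many words of length `l`, so one bound serves all of them; in a longer word
the last `l` letters act first. This allows an element to be replaced by its multiples of higher
degree. -/
theorem isTorsionElement_of_word_smul {M : GrMod (grading k n)} {m : M} (l : ℕ)
    (h : ∀ w : List (Fin (n + 1)), w.length = l → IsTorsionElement (word k n w • m)) :
    IsTorsionElement m := by
  choose! g hg using h
  obtain ⟨b, hb⟩ := ((finite_lists_length_eq (n := n) l).image g).bddAbove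
  refine ⟨b + l, fun w hw => ?_⟩
  rw [← List.take_append_drop (w.length - l) w, word_append, mul_smul]
  have hd : (w.drop (w.length - l)).length = l := by rw [List.length_drop]; omega
  refine hg _ hd _ ((hb ⟨_, hd, rfl⟩).trans ?_)
  rw [List.length_take]
  omega

/-- The submodule generated by `m` is spanned over `k` by the multiples `w • m` with `w` shorter
than the bound, and the alphabet is finite. -/
theorem IsTorsionElement.finiteDimensional {M : GrMod (grading k n)} {m : M}
    (hm : IsTorsionElement m) :
    FiniteDimensional k (Submodule.span (FreeAlg k n) {m}) := by
  obtain ⟨l, hl⟩ := hm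
  have hfin : Set.Finite ((fun w => word k n w • m) '' {w | w.length < l}) :=
    (List.finite_length_lt _ l).image _
  have := FiniteDimensional.span_of_finite k hfin
  have hle : (Submodule.span (FreeAlg k n) {m}).restrictScalars k ≤
      Submodule.span k ((fun w => word k n w • m) '' {w | w.length < l}) := by
    intro x hx
    obtain ⟨a, rfl⟩ := Submodule.mem_span_singleton.1 hx
    have ha : a ∈ Submodule.span k (Set.range (word k n)) := by
      rw [span_word]
      exact Submodule.mem_top
    induction ha using Submodule.span_induction with
    | mem a h =>
      obtain ⟨w, rfl⟩ := h
      rcases lt_or_ge w.length l with h | h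
      · exact Submodule.subset_span ⟨w, h, rfl⟩
      · rw [hl w h]
        exact Submodule.zero_mem _
    | zero =>
      rw [zero_smul]
      exact Submodule.zero_mem _
    | add a b _ _ iha ihb =>
      rw [add_smul]
      exact Submodule.add_mem _
        (iha (Submodule.smul_mem _ _ (Submodule.mem_span_singleton_self m)))
        (ihb (Submodule.smul_mem _ _ (Submodule.mem_span_singleton_self m)))
    | smul c a _ iha =>
      rw [smul_assoc]
      exact Submodule.smul_mem _ _
        (iha (Submodule.smul_mem _ _ (Submodule.mem_span_singleton_self m)))
  exact Submodule.finiteDimensional_of_le hle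

/-- Otherwise some word of each length does not kill `m`; these multiples of `m` lie in distinct
degrees and are therefore linearly independent. -/
theorem isTorsionElement_of_finiteDimensional {M : GrMod (grading k n)} {d : ℤ} {m : M}
    (hd : m ∈ M.deg d) (hm : FiniteDimensional k (Submodule.span (FreeAlg k n) {m})) :
    IsTorsionElement m := by
  by_contra h
  unfold IsTorsionElement at h
  push Not at h
  have h' : ∀ l : ℕ, ∃ w : List (Fin (n + 1)), w.length = l ∧ word k n w • m ≠ 0 := by
    intro l
    obtain ⟨w, hw, hne⟩ := h l
    -- A suffix acts before the rest of the word, so a word that does not kill `m` has no suffix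
    -- killing `m`.
    refine ⟨w.drop (w.length - l), by rw [List.length_drop]; omega, fun h0 => hne ?_⟩
    rw [← List.take_append_drop (w.length - l) w, word_append, mul_smul, h0, smul_zero]
  choose w hw hne using h'
  have hind : iSupIndep fun l : ℕ => M.deg (l + d) :=
    M.isInternal.submodule_iSupIndep.comp (f := fun l : ℕ => (l : ℤ) + d)
      fun a b hab => by simpa using hab
  have hli : LinearIndependent k fun l : ℕ => word k n (w l) • m :=
    hind.linearIndependent _ (fun l => by
      have := word_smul_mem_deg hd (w l)
      rwa [hw l] at this) hne
  have hmem : ∀ l : ℕ, word k n (w l) • m ∈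
      (Submodule.span (FreeAlg k n) {m}).restrictScalars k := fun l =>
    Submodule.smul_mem _ _ (Submodule.mem_span_singleton_self m)
  have hli' : LinearIndependent k fun l : ℕ =>
      (⟨_, hmem l⟩ : (Submodule.span (FreeAlg k n) {m}).restrictScalars k) :=
    LinearIndependent.of_comp (Submodule.subtype _) hli
  have : FiniteDimensional k ((Submodule.span (FreeAlg k n) {m}).restrictScalars k) := hm
  exact not_finite_iff_infinite.2 (inferInstanceAs (Infinite ℕ)) hli'.finite

theorem fdim_iff_isTorsionElement (M : GrMod (grading k n)) :
    GrMod.Fdim (grading k n) M ↔ ∀ m : M, IsTorsionElement m := by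
  rw [GrMod.fdim_iff]
  refine ⟨fun h m => ?_, fun h m => (h m).finiteDimensional⟩
  induction m using M.induction_on with
  | h0 => exact ⟨0, fun w _ => smul_zero _⟩
  | hadd x y hx hy => exact hx.add hy
  | hdeg i x hx => exact isTorsionElement_of_finiteDimensional hx (h x)

/-! ### `R_{≥ i}` as the free module on the words of length `i`, and morphisms out of it. -/

variable (k n)

theorem mem_geIdeal_word {i : ℕ} {w : List (Fin (n + 1))} (h : i ≤ w.length) :
    (word k n w : regular k n) ∈ geIdeal k n i :=
  mem_geSubspace k n (j := w.length) (by exact_mod_cast h) (word_mem k n w)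

theorem geSubspace_le {i : ℕ} {S : Submodule k (regular k n)}
    (h : ∀ w : List (Fin (n + 1)), i ≤ w.length → word k n w ∈ S) : geSubspace k n i ≤ S := by
  refine iSup₂_le fun j hj => ?_
  change grading k n j ≤ S
  rw [grading_eq_span]
  refine Submodule.span_le.2 ?_
  rintro _ ⟨w, rfl, rfl⟩
  exact h w (by exact_mod_cast hj)

/-- A word of length at least `i`, as an element of `R_{≥ i}`. -/
noncomputable def geWord (i : ℕ) (w : List (Fin (n + 1))) (h : i ≤ w.length) : ge k n i :=
  (⟨word k n w, mem_geIdeal_word k n h⟩ : geIdeal k n i)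

variable {k n}

theorem geWord_eq_smul {i : ℕ} (v w : List (Fin (n + 1))) (h : i ≤ w.length)
    (h' : i ≤ (v ++ w).length) :
    geWord k n i (v ++ w) h' = word k n v • geWord k n i w h :=
  Subtype.ext (word_append k n v w)

theorem geWord_mem_deg {i : ℕ} (w : List (Fin (n + 1))) (h : i ≤ w.length) :
    geWord k n i w h ∈ (ge k n i).deg w.length :=
  word_mem k n w

/-- `R_{≥ i}` is generated by the words of length `i`. -/
theorem eq_top_of_geWord_mem {i : ℕ} (S : Submodule (FreeAlg k n) (ge k n i))
    (h : ∀ (w : List (Fin (n + 1))) (hw : w.length = i), geWord k n i w hw.ge ∈ S) : S = ⊤ := by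
  rw [eq_top_iff]
  rintro ⟨x, hx⟩ -
  have hle : geSubspace k n i ≤
      (S.restrictScalars k).map ((geIdeal k n i).subtype.restrictScalars k) := by
    refine geSubspace_le k n fun w hw => ⟨geWord k n i w hw, ?_, rfl⟩
    have hd : (w.drop (w.length - i)).length = i := by rw [List.length_drop]; omega
    have := S.smul_mem (word k n (w.take (w.length - i))) (h _ hd)
    rw [← geWord_eq_smul _ _ _ (by rw [List.take_append_drop]; exact hw)] at this
    simp only [List.take_append_drop] at this
    exact this
  obtain ⟨y, hy, hyx⟩ := hle hx
  have : y = ⟨x, hx⟩ := Subtype.ext hyx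
  exact this ▸ hy

theorem ge_hom_ext {i : ℕ} {N : GrMod (grading k n)} {f g : ge k n i ⟶ N}
    (h : ∀ (w : List (Fin (n + 1))) (hw : w.length = i),
      GrMod.lin f (geWord k n i w hw.ge) = GrMod.lin g (geWord k n i w hw.ge)) : f = g := by
  refine GrMod.hom_ext' fun m => ?_
  have := eq_top_of_geWord_mem (LinearMap.eqLocus (GrMod.lin f) (GrMod.lin g)) h
  exact (this ▸ Submodule.mem_top : m ∈ LinearMap.eqLocus (GrMod.lin f) (GrMod.lin g))

section GeHom

variable {i : ℕ} {N : GrMod (grading k n)} (v : List (Fin (n + 1)) → N)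

/-- The `k`-linear map that sends a word `a ++ b` with `b` of length `i` to `a • v b`, and words of
length less than `i` to zero. -/
noncomputable def wordMap (i : ℕ) (v : List (Fin (n + 1)) → N) : FreeAlg k n →ₗ[k] N :=
  (FreeAlgebra.basisFreeMonoid k (Fin (n + 1))).constr ℕ fun w =>
    if i ≤ w.toList.length then
      word k n (w.toList.take (w.toList.length - i)) • v (w.toList.drop (w.toList.length - i))
    else 0

theorem wordMap_word (w : List (Fin (n + 1))) :
    wordMap i v (word k n w) = if i ≤ w.length then
      word k n (w.take (w.length - i)) • v (w.drop (w.length - i)) else 0 := by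
  rw [← basisFreeMonoid_eq_word]
  exact Module.Basis.constr_basis _ _ _ _

theorem wordMap_append {a b : List (Fin (n + 1))} (hb : b.length = i) :
    wordMap i v (word k n (a ++ b)) = word k n a • v b := by
  rw [wordMap_word, if_pos (by rw [List.length_append]; omega)]
  have : (a ++ b).length - i = a.length := by rw [List.length_append]; omega
  rw [this, List.take_left, List.drop_left]

/-- Multiplying a word of length at least `i` on the left leaves its last `i` letters unchanged. The
restriction on `x` matters: shorter words are sent to zero, though their multiples need not be. -/
theorem wordMap_mul (a x : FreeAlg k n) (hx : x ∈ geSubspace k n i) :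
    wordMap i v (a * x) = a • wordMap i v x := by
  have ha : a ∈ Submodule.span k (Set.range (word k n)) := by
    rw [span_word]
    exact Submodule.mem_top
  induction ha using Submodule.span_induction with
  | zero => rw [zero_mul, zero_smul, map_zero]
  | add a b _ _ iha ihb => rw [add_mul, add_smul, map_add, iha, ihb]
  | smul c a _ iha => rw [smul_mul_assoc, map_smul, iha, smul_assoc]
  | mem a h =>
    obtain ⟨w, rfl⟩ := h
    have hle : geSubspace k n i ≤ LinearMap.eqLocus
        (wordMap i v ∘ₗ LinearMap.mulLeft k (word k n w))
        (Algebra.lsmul k k N (word k n w) ∘ₗ wordMap i v) := by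
      refine geSubspace_le k n fun u hu => ?_
      change wordMap i v (word k n w * word k n u) = word k n w • wordMap i v (word k n u)
      have hd : (u.drop (u.length - i)).length = i := by rw [List.length_drop]; omega
      rw [← word_append]
      conv_lhs => rw [← List.take_append_drop (u.length - i) u]
      conv_rhs => rw [← List.take_append_drop (u.length - i) u]
      rw [← List.append_assoc, wordMap_append v hd, wordMap_append v hd, word_append, mul_smul]
    exact hle hx

variable (hv : ∀ w : List (Fin (n + 1)), w.length = i → v w ∈ N.deg i)

/-- The morphism `R_{≥ i} ⟶ N` with given values on the words of length `i`. -/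
noncomputable def geHom : ge k n i ⟶ N :=
  GrMod.homMk (M := ge k n i)
    { toFun := fun x => wordMap i v x.1
      map_add' := fun x y => map_add (wordMap i v) x.1 y.1
      map_smul' := fun a x => wordMap_mul v a x.1 x.2 }
    fun l x hx => by
      have hle : grading k n l ≤ (N.deg l).comap (wordMap i v) := by
        rw [grading_eq_span]
        refine Submodule.span_le.2 ?_
        rintro _ ⟨w, rfl, rfl⟩
        change wordMap i v (word k n w) ∈ N.deg (w.length : ℤ)
        rw [wordMap_word]
        split_ifs with h
        · have hd : (w.drop (w.length - i)).length = i := by rw [List.length_drop]; omega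
          have := word_smul_mem_deg (hv _ hd) (w.take (w.length - i))
          rw [List.length_take] at this
          convert this using 2
          omega
        · exact Submodule.zero_mem _
      exact hle hx

/-- With `ge_hom_ext`, this is the universal property of the free module on the words of length `i`.
-/
theorem geHom_geWord (w : List (Fin (n + 1))) (hw : w.length = i) :
    GrMod.lin (geHom v hv) (geWord k n i w hw.ge) = v w := by
  refine (wordMap_append v (a := []) hw).trans ?_
  rw [word_nil, one_smul]

end GeHom

/-- A morphism `R_{≥ i} ⟶ N` lifts, after restriction to some `R_{≥ j}`, along a morphism to `N`
with torsion cokernel. -/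
theorem exists_ge_lift {Q N : GrMod (grading k n)} (s : Q ⟶ N)
    (hs : ∀ y : N, ∃ l : ℕ, ∀ w : List (Fin (n + 1)), l ≤ w.length →
      word k n w • y ∈ LinearMap.range (GrMod.lin s)) {i : ℕ} (f : ge k n i ⟶ N) :
    ∃ (j : ℕ) (h : i ≤ j) (f' : ge k n j ⟶ Q), f' ≫ s = geIncl k n h ≫ f := by
  choose g hg using hs
  let c : {w : List (Fin (n + 1)) // w.length = i} → ℕ := fun w =>
    g (GrMod.lin f (geWord k n i w w.2.ge))
  have : Finite {w : List (Fin (n + 1)) // w.length = i} := finite_lists_length_eq i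
  obtain ⟨b, hb⟩ := (Set.finite_range c).bddAbove
  -- A word of length `b + i` is a word of length `b` times one of length `i`, and `b` bounds the
  -- lengths needed to bring the values at the latter into the range of `s`.
  refine ⟨b + i, Nat.le_add_left i b, ?_⟩
  have hmem : ∀ w : List (Fin (n + 1)), ∀ hw : w.length = b + i, ∃ q ∈ Q.deg (b + i : ℕ),
      GrMod.lin s q = GrMod.lin f (geWord k n i w (by omega)) := by
    intro w hw
    have hd : (w.drop b).length = i := by rw [List.length_drop]; omega
    have h1 := hg (GrMod.lin f (geWord k n i (w.drop b) hd.ge)) (w.take b)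
      ((hb ⟨⟨w.drop b, hd⟩, rfl⟩).trans (by rw [List.length_take]; omega))
    rw [← map_smul, ← geWord_eq_smul _ _ _ (by rw [List.take_append_drop]; omega)] at h1
    simp only [List.take_append_drop] at h1
    obtain ⟨q, hq⟩ := h1
    -- The value to be lifted is homogeneous of degree `b + i`, so the component of `q` in that
    -- degree is again a preimage; `geHom` needs homogeneous values.
    refine ⟨Q.proj (b + i : ℕ) q, Q.proj_mem _ _, ?_⟩
    rw [GrMod.lin_proj, hq]
    refine N.proj_of_mem (GrMod.lin_mem f ?_)
    rw [← hw]
    exact geWord_mem_deg w _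
  choose! v hv hv' using hmem
  refine ⟨geHom v hv, ge_hom_ext fun w hw => ?_⟩
  rw [GrMod.lin_comp, geHom_geWord v hv w hw, hv' w hw]
  rfl

/-- A morphism `R_{≥ i} ⟶ N` with torsion values vanishes on some `R_{≥ j}`. -/
theorem exists_geIncl_comp_eq_zero {N : GrMod (grading k n)} {i : ℕ} (f : ge k n i ⟶ N)
    (hf : ∀ x, IsTorsionElement (GrMod.lin f x)) :
    ∃ (j : ℕ) (h : i ≤ j), geIncl k n h ≫ f = 0 := by
  have hg := GrMod.isGraded_range f
  have hf' : ∀ x, GrMod.lin f x ∈ LinearMap.range (GrMod.lin f) := fun x => ⟨x, rfl⟩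
  -- The zero map into the range of `f` has torsion cokernel, and a map that lifts along it is zero.
  obtain ⟨j, h, f', e⟩ := exists_ge_lift (0 : GrMod.zero (grading k n) ⟶ N.sub _ hg)
    (by
      rintro ⟨_, x, rfl⟩
      obtain ⟨l, hl⟩ := hf x
      refine ⟨l, fun w hw => ⟨0, Subtype.ext ?_⟩⟩
      exact (hl w hw).symm)
    (GrMod.subLift _ hg f hf')
  refine ⟨j, h, ?_⟩
  rw [← GrMod.subLift_comp_subι _ hg f hf', ← Category.assoc, ← e, comp_zero, zero_comp]

end FreeAlg

/-! ### The quotient functor in terms of torsion elements. -/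

namespace FreeAlg

variable {k : Type u} [Field k] {n : ℕ}

theorem IsTorsionElement.map {M N : GrMod (grading k n)} (f : M ⟶ N) {m : M}
    (hm : IsTorsionElement m) : IsTorsionElement (GrMod.lin f m) := by
  obtain ⟨l, hl⟩ := hm
  refine ⟨l, fun w hw => ?_⟩
  rw [← map_smul, hl w hw, map_zero]

theorem IsTorsionElement.of_map {M N : GrMod (grading k n)} (f : M ⟶ N)
    (hf : Function.Injective (GrMod.lin f)) {m : M} (hm : IsTorsionElement (GrMod.lin f m)) :
    IsTorsionElement m := by
  obtain ⟨l, hl⟩ := hm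
  refine ⟨l, fun w hw => hf ?_⟩
  rw [map_smul, hl w hw, map_zero]

/-- The quotient functor `π* : Gr R ⥤ QGr R`. -/
noncomputable abbrev quotientFunctor (k : Type u) [Field k] (n : ℕ) :
    GrMod (grading k n) ⥤ QGr (grading k n) :=
  QGr.quotientFunctor (grading k n)

local notation "π" => quotientFunctor k n

/-- Puts the condition on the cokernel into the form that `exists_ge_lift` requires. -/
theorem fdim_coker_iff {M N : GrMod (grading k n)} (f : M ⟶ N) :
    GrMod.Fdim (grading k n) (GrMod.coker f) ↔ ∀ y : N, ∃ l : ℕ, ∀ w : List (Fin (n + 1)),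
      l ≤ w.length → word k n w • y ∈ LinearMap.range (GrMod.lin f) := by
  rw [fdim_iff_isTorsionElement]
  constructor
  · intro h y
    obtain ⟨l, hl⟩ := h (GrMod.lin (N.quotπ _ (GrMod.isGraded_range f)) y)
    exact ⟨l, fun w hw => (Submodule.Quotient.mk_eq_zero _).1 (hl w hw)⟩
  · intro h y
    obtain ⟨y, rfl⟩ := Submodule.mkQ_surjective _ y
    obtain ⟨l, hl⟩ := h y
    exact ⟨l, fun w hw => (Submodule.Quotient.mk_eq_zero _).2 (hl w hw)⟩

/-- A morphism dies in the quotient exactly when its image belongs to `Fdim`, and the image consists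
of the values of `f`. -/
theorem quotientFunctor_map_eq_zero_iff {M N : GrMod (grading k n)} (f : M ⟶ N) :
    (π).map f = 0 ↔ ∀ x, IsTorsionElement (GrMod.lin f x) := by
  rw [ObjectProperty.SerreClassLocalization.map_eq_zero_iff _ (GrMod.Fdim (grading k n)),
    fdim_iff_isTorsionElement]
  constructor
  · intro h x
    have := (h (GrMod.lin (Abelian.factorThruImage f) x)).map (Abelian.image.ι f)
    rwa [← GrMod.lin_comp, Abelian.image.fac] at this
  · intro h y
    obtain ⟨x, rfl⟩ := GrMod.surjective_of_epi (Abelian.factorThruImage f) y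
    refine IsTorsionElement.of_map (Abelian.image.ι f) (GrMod.injective_of_mono _) ?_
    rw [← GrMod.lin_comp, Abelian.image.fac]
    exact h x

theorem isIso_quotientFunctor_map {M N : GrMod (grading k n)} (f : M ⟶ N)
    (hf : Function.Injective (GrMod.lin f))
    (hc : ∀ y : N, ∃ l : ℕ, ∀ w : List (Fin (n + 1)), l ≤ w.length →
      word k n w • y ∈ LinearMap.range (GrMod.lin f)) : IsIso ((π).map f) := by
  refine Localization.inverts _ (GrMod.Fdim (grading k n)).isoModSerre f
    ((GrMod.isoModSerre_iff f).2 ⟨?_, (fdim_coker_iff f).2 hc⟩)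
  rw [fdim_iff_isTorsionElement]
  rintro ⟨x, hx⟩
  have h0 : x = 0 := hf (hx.trans (map_zero _).symm)
  subst h0
  exact ⟨0, fun w _ => smul_zero _⟩

theorem coker_of_isoModSerre {M N : GrMod (grading k n)} {f : M ⟶ N}
    (hf : (GrMod.Fdim (grading k n)).isoModSerre f) (y : N) :
    ∃ l : ℕ, ∀ w : List (Fin (n + 1)), l ≤ w.length →
      word k n w • y ∈ LinearMap.range (GrMod.lin f) :=
  (fdim_coker_iff f).1 ((GrMod.isoModSerre_iff f).1 hf).2 y

theorem coker_of_epi_map {M N : GrMod (grading k n)} (f : M ⟶ N) [Epi ((π).map f)] (y : N) :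
    ∃ l : ℕ, ∀ w : List (Fin (n + 1)), l ≤ w.length →
      word k n w • y ∈ LinearMap.range (GrMod.lin f) := by
  have h := (ObjectProperty.SerreClassLocalization.epi_map_iff (π)
    (GrMod.Fdim (grading k n)) f).1 inferInstance
  refine (fdim_coker_iff f).1 ?_ y
  exact ((GrMod.Fdim (grading k n)).prop_iff_of_iso
    ((cokernelIsCokernel f).coconePointUniqueUpToIso (GrMod.cokerIsCokernel f))).1 h

/-- Since `R` has no negative degrees, words of length at least `i` carry all of `R` into `R_{≥ i}`;
hence `R / R_{≥ i}` is torsion. -/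
theorem word_mul_mem_geIdeal {i : ℕ} {w : List (Fin (n + 1))} (hw : i ≤ w.length)
    (y : FreeAlg k n) : (word k n w * y : regular k n) ∈ geIdeal k n i := by
  have hy : y ∈ Submodule.span k (Set.range (word k n)) := by
    rw [span_word]
    exact Submodule.mem_top
  induction hy using Submodule.span_induction with
  | mem y h =>
    obtain ⟨v, rfl⟩ := h
    rw [← word_append]
    exact mem_geIdeal_word k n (by rw [List.length_append]; omega)
  | zero =>
    rw [mul_zero]
    exact Submodule.zero_mem _
  | add x y _ _ hx hy =>
    rw [mul_add]
    exact Submodule.add_mem _ hx hy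
  | smul c x _ hx =>
    rw [mul_smul_comm]
    exact Submodule.smul_of_tower_mem (geIdeal k n i) c hx

instance isIso_map_geι (i : ℕ) : IsIso ((π).map (geι k n i)) :=
  isIso_quotientFunctor_map _ Subtype.val_injective fun y =>
    ⟨i, fun _ hw => ⟨⟨_, word_mul_mem_geIdeal hw y⟩, rfl⟩⟩

/-! ### Morphisms out of `𝒪`; the generator property and projectivity. -/

theorem essSurj_quotientFunctor : (π).EssSurj :=
  Localization.essSurj _ (GrMod.Fdim (grading k n)).isoModSerre

/-- Every morphism out of `𝒪` is represented by a morphism out of some `R_{≥ i}`. -/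
theorem exists_ge_hom {N : GrMod (grading k n)} (φ : structureSheaf k n ⟶ (π).obj N) :
    ∃ (i : ℕ) (f : ge k n i ⟶ N), (π).map (geι k n i) ≫ φ = (π).map f := by
  obtain ⟨ψ, hψ⟩ := Localization.exists_rightFraction (π)
    (GrMod.Fdim (grading k n)).isoModSerre φ
  -- The inclusion `R_{≥ 0} → R` plays the role of the identity of `R`; lifting it along the
  -- denominator `ψ.s` replaces that denominator by some `geι k n j`.
  obtain ⟨j, h, f', e⟩ := exists_ge_lift ψ.s (coker_of_isoModSerre ψ.hs) (geι k n 0)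
  rw [geIncl_comp_geι] at e
  refine ⟨j, f' ≫ ψ.f, ?_⟩
  rw [← e, Functor.map_comp, Functor.map_comp, hψ, Category.assoc,
    MorphismProperty.RightFraction.map_s_comp_map]

/-- Up to isomorphism of its source, a morphism of `QGr R` comes from `Gr R`. -/
theorem exists_map_eq {X : QGr (grading k n)} {N : GrMod (grading k n)} (φ : X ⟶ (π).obj N) :
    ∃ (M : GrMod (grading k n)) (e : (π).obj M ≅ X) (g : M ⟶ N), e.hom ≫ φ = (π).map g := by
  have := essSurj_quotientFunctor (k := k) (n := n)
  obtain ⟨ψ, hψ⟩ := Localization.exists_rightFraction (π)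
    (GrMod.Fdim (grading k n)).isoModSerre (((π).objObjPreimageIso X).hom ≫ φ)
  have := Localization.inverts (π) (GrMod.Fdim (grading k n)).isoModSerre ψ.s ψ.hs
  refine ⟨ψ.X', asIso ((π).map ψ.s) ≪≫ (π).objObjPreimageIso X, ψ.f, ?_⟩
  rw [Iso.trans_hom, asIso_hom, Category.assoc, hψ,
    MorphismProperty.RightFraction.map_s_comp_map]

/-- For a representative `g` of `φ`, the values at elements of degree `i ≥ 0` are values of
composites `R_{≥ i} ⟶ M ⟶ N`. The hypothesis makes these composites vanish in `QGr R`, so the values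
are torsion. -/
theorem isSeparator_structureSheaf : IsSeparator (structureSheaf k n) := by
  rw [Preadditive.isSeparator_iff]
  have := essSurj_quotientFunctor (k := k) (n := n)
  intro X Y φ hφ
  obtain ⟨M, e, g, hg⟩ := exists_map_eq (φ ≫ ((π).objObjPreimageIso Y).inv)
  have h0 : (π).map g = 0 := by
    rw [quotientFunctor_map_eq_zero_iff]
    intro m
    induction m using M.induction_on with
    | h0 =>
      rw [map_zero]
      exact ⟨0, fun w _ => smul_zero _⟩
    | hadd x y hx hy =>
      rw [map_add]
      exact hx.add hy
    | hdeg d m hm =>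
      -- Words of length `max (-d) 0` move `m` into nonnegative degree, where maps from `R_{≥ i}`
      -- can reach it.
      refine isTorsionElement_of_word_smul (-d).toNat fun v hv => ?_
      have hd := word_smul_mem_deg hm v
      obtain ⟨i, hi⟩ : ∃ i : ℕ, (v.length : ℤ) + d = i := ⟨(v.length + d).toNat, by omega⟩
      rw [hi] at hd
      -- All words of length `i` may be given the same value; it is recovered below at the word
      -- consisting of `i` letters `x₀`.
      let f : ge k n i ⟶ M := geHom (fun _ => word k n v • m) fun _ _ => hd
      have hf : (π).map (f ≫ g) = 0 := by
        rw [← cancel_epi (inv ((π).map (geι k n i))), comp_zero, Functor.map_comp, ← hg,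
          ← cancel_mono ((π).objObjPreimageIso Y).hom, zero_comp]
        simp only [Category.assoc, Iso.inv_hom_id, Category.comp_id]
        have := hφ (inv ((π).map (geι k n i)) ≫ (π).map f ≫ e.hom)
        simpa only [Category.assoc] using this
      have := (quotientFunctor_map_eq_zero_iff (f ≫ g)).1 hf
        (geWord k n i (List.replicate i 0) List.length_replicate.ge)
      rwa [GrMod.lin_comp, geHom_geWord _ _ _ List.length_replicate, map_smul] at this
  rw [h0] at hg
  rw [← cancel_epi e.hom, ← cancel_mono ((π).objObjPreimageIso Y).inv, Category.assoc, hg,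
    comp_zero, zero_comp]

/-- An epimorphism is represented by a graded map `g` with torsion cokernel and `φ` by a map from
`R_{≥ i}`; the latter lifts along `g` on some `R_{≥ j}`, which is still `𝒪` in the quotient. -/
instance projective_structureSheaf : Projective (structureSheaf k n) where
  factors {Y X} φ p hp := by
    have := essSurj_quotientFunctor (k := k) (n := n)
    obtain ⟨M, e, g, hg⟩ := exists_map_eq (p ≫ ((π).objObjPreimageIso X).inv)
    have : Epi ((π).map g) := by
      rw [← hg]
      infer_instance
    obtain ⟨i, f, hf⟩ := exists_ge_hom (φ ≫ ((π).objObjPreimageIso X).inv)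
    obtain ⟨j, h, f', hf'⟩ := exists_ge_lift g (coker_of_epi_map g) f
    refine ⟨inv ((π).map (geι k n j)) ≫ (π).map f' ≫ e.hom, ?_⟩
    rw [← cancel_mono ((π).objObjPreimageIso X).inv]
    simp only [Category.assoc]
    rw [hg, ← Functor.map_comp, hf', Functor.map_comp, ← hf, IsIso.inv_comp_eq,
      ← Functor.map_comp_assoc, geIncl_comp_geι]

/-! ### Copowers of `𝒪`. -/

/-- The quotient category is abelian. -/
noncomputable instance : Abelian (QGr (grading k n)) :=
  ObjectProperty.SerreClassLocalization.abelian (π) (GrMod.Fdim (grading k n))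

/-- The inclusion of a direct sum of modules `R_{≥ i}` into a direct sum of copies of `R` becomes
an isomorphism in `QGr R`. -/
theorem isIso_map_directSumMap_geι {I : Type u} (i : I → ℕ) :
    IsIso ((π).map (GrMod.directSumMap fun a => geι k n (i a))) := by
  refine isIso_quotientFunctor_map _
    (GrMod.directSumMap_injective _ fun a => Subtype.val_injective) fun y => ?_
  obtain ⟨T, hT⟩ := GrMod.exists_finset_directSumπ y
  -- Although `i` may be unbounded on `I`, only the finitely many nonzero components of `y`, indexed
  -- by `T`, must be moved into their `R_{≥ i a}`.
  refine ⟨T.sup i, fun w hw => ?_⟩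
  rw [← GrMod.sum_directSumι_directSumπ y hT, Finset.smul_sum]
  refine Submodule.sum_mem _ fun a ha => ?_
  let z : ge k n (i a) := (⟨_, word_mul_mem_geIdeal ((Finset.le_sup ha).trans hw)
    (GrMod.lin (GrMod.directSumπ (fun _ : I => regular k n) a) y)⟩ : geIdeal k n (i a))
  refine ⟨GrMod.lin (GrMod.directSumι _ a) z, ?_⟩
  rw [← GrMod.lin_comp, GrMod.directSumι_map, GrMod.lin_comp, ← map_smul]
  rfl

/-- The image of a morphism from `R_{≥ i}` to a direct sum lies in a finite direct sum. -/
theorem exists_finset_ge_hom {I : Type u} {M : I → GrMod (grading k n)} {i : ℕ}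
    (f : ge k n i ⟶ GrMod.directSum M) :
    ∃ T : Finset I, f = ∑ a ∈ T, (f ≫ GrMod.directSumπ M a) ≫ GrMod.directSumι M a := by
  classical
  have : Finite {w : List (Fin (n + 1)) // w.length = i} := finite_lists_length_eq i
  have := Fintype.ofFinite {w : List (Fin (n + 1)) // w.length = i}
  choose T hT using fun w : {w : List (Fin (n + 1)) // w.length = i} =>
    GrMod.exists_finset_directSumπ (GrMod.lin f (geWord k n i w w.2.ge))
  refine ⟨Finset.univ.biUnion T, ge_hom_ext fun w hw => ?_⟩
  rw [GrMod.lin_sum]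
  refine (GrMod.sum_directSumι_directSumπ _ fun a ha => hT ⟨w, hw⟩ a fun h => ha ?_).symm
  exact Finset.mem_biUnion.2 ⟨_, Finset.mem_univ _, h⟩

/-- The image of `R^(I)` in `QGr R` is the copower of `𝒪` indexed by `I`. -/
theorem isSpanningCopower_directSum (I : Type u) :
    IsSpanningCopower (G := structureSheaf k n) fun a : I =>
      (π).map (GrMod.directSumι (fun _ => regular k n) a) where
  exists_desc {Y} ψ := by
    have := essSurj_quotientFunctor (k := k) (n := n)
    -- The `i a` may be unbounded, so no single `R_{≥ j}` need represent all `ψ a`; the direct sum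
    -- of the `R_{≥ i a}` does.
    choose i f hf using fun a => exists_ge_hom (ψ a ≫ ((π).objObjPreimageIso Y).inv)
    let s := GrMod.directSumMap fun a => geι k n (i a)
    have hs : IsIso ((π).map s) := isIso_map_directSumMap_geι i
    refine ⟨inv ((π).map s) ≫ (π).map (GrMod.directSumDesc f) ≫ ((π).objObjPreimageIso Y).hom,
      fun a => ?_⟩
    rw [← cancel_epi ((π).map (geι k n (i a))), ← cancel_mono ((π).objObjPreimageIso Y).inv]
    simp only [Category.assoc, Iso.hom_inv_id, Category.comp_id]
    rw [hf, ← GrMod.directSumι_desc f a, Functor.map_comp, ← Functor.map_comp_assoc,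
      ← GrMod.directSumι_map (fun a => geι k n (i a)) a, Functor.map_comp, Category.assoc]
    exact congrArg _ (IsIso.hom_inv_id_assoc ((π).map s) _)
  span_eq_top := by
    rw [eq_top_iff]
    intro φ _
    obtain ⟨i, f, hf⟩ := exists_ge_hom φ
    obtain ⟨T, hT⟩ := exists_finset_ge_hom f
    -- The coordinates of `φ` are the components of its representative `f`; finitely many suffice
    -- because `R_{≥ i}` is finitely generated.
    let c : I → End (structureSheaf k n) := fun a => inv ((π).map (geι k n i)) ≫
      (π).map (f ≫ GrMod.directSumπ (fun _ => regular k n) a)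
    have hφ : φ = ∑ a ∈ T, c a ≫ (π).map (GrMod.directSumι (fun _ => regular k n) a) := by
      rw [← cancel_epi ((π).map (geι k n i)), hf, Preadditive.comp_sum]
      conv_lhs => rw [hT]
      rw [Functor.map_sum]
      simp [c]
    rw [hφ]
    refine Submodule.sum_mem _ fun a _ => ?_
    exact Submodule.smul_mem _ (MulOpposite.op (c a)) (Submodule.subset_span ⟨a, rfl⟩)

end FreeAlg

/-! ### The endomorphism algebra of `𝒪` as a direct limit. -/

namespace FreeAlg

variable (k : Type u) [Field k] (n : ℕ)

local notation "π" => quotientFunctor k n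

/-- The endomorphism of `𝒪` that an endomorphism of `R_{≥ i}` induces. -/
noncomputable def geEndHom (i : ℕ) : End (ge k n i) →ₐ[k] End (structureSheaf k n) :=
  AlgHom.ofLinearMap
    { toFun := fun f => inv ((π).map (geι k n i)) ≫ (π).map f ≫ (π).map (geι k n i)
      map_add' := fun f g => by
        rw [← Preadditive.comp_add, ← Preadditive.add_comp, ← Functor.map_add]
      map_smul' := fun c f => by
        rw [RingHom.id_apply, ← Linear.comp_smul, ← Linear.smul_comp, ← Functor.map_smul] }
    (by
      change inv ((π).map (geι k n i)) ≫ (π).map (𝟙 _) ≫ (π).map (geι k n i) = 𝟙 _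
      simp)
    fun f g => by
      change inv ((π).map (geι k n i)) ≫ (π).map (g ≫ f) ≫ (π).map (geι k n i) =
        (inv ((π).map (geι k n i)) ≫ (π).map g ≫ (π).map (geι k n i)) ≫
          inv ((π).map (geι k n i)) ≫ (π).map f ≫ (π).map (geι k n i)
      simp

theorem map_geι_geEndHom (i : ℕ) (f : End (ge k n i)) :
    (π).map (geι k n i) ≫ geEndHom k n i f = (π).map f ≫ (π).map (geι k n i) :=
  IsIso.hom_inv_id_assoc _ _

theorem geEndHom_restrictHom {i j : ℕ} (h : i ≤ j) (f : End (ge k n i)) :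
    geEndHom k n i f = geEndHom k n j (restrictHom k n i j h f) := by
  rw [← cancel_epi ((π).map (geι k n j)), map_geι_geEndHom, restrictHom_apply,
    ← Functor.map_comp, restrict_comp_geι, ← geIncl_comp_geι k n h, Functor.map_comp,
    Category.assoc, map_geι_geEndHom, Functor.map_comp, Functor.map_comp]

/-- The homomorphism from the direct limit of the algebras `End(R_{≥ i})` to `End 𝒪`. -/
noncomputable def endLimitHom : EndLimit k n →ₐ[k] End (structureSheaf k n) :=
  have compat : ∀ i j h (f : End (ge k n i)),
      geEndHom k n i f = geEndHom k n j (restrictHom k n i j h f) :=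
    fun _ _ h => geEndHom_restrictHom k n h
  AlgHom.ofLinearMap
    { toFun := DirectLimit.lift (restrictHom k n) (fun i => geEndHom k n i) compat
      map_add' := fun x y => DirectLimit.lift_add (geEndHom k n) compat x y
      map_smul' := fun c x => DirectLimit.lift_smul (geEndHom k n) compat c x }
    (DirectLimit.lift_one (geEndHom k n) compat)
    fun x y => DirectLimit.lift_mul (geEndHom k n) compat x y

theorem endLimitHom_mk (i : ℕ) (f : End (ge k n i)) :
    endLimitHom k n (Quotient.mk _ ⟨i, f⟩) = geEndHom k n i f := rfl

/-- If `f` becomes zero in `QGr R`, its values are torsion. Hence `f` vanishes on some `R_{≥ j}`,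
and its class in the limit is zero. -/
theorem endLimitHom_injective : Function.Injective (endLimitHom k n) := by
  rw [injective_iff_map_eq_zero]
  intro x hx
  obtain ⟨i, f, rfl⟩ := DirectLimit.exists_eq_mk _ x
  rw [endLimitHom_mk] at hx
  have h0 : (π).map f = 0 := by
    rw [← cancel_mono ((π).map (geι k n i)), ← map_geι_geEndHom, hx, comp_zero, zero_comp]
  obtain ⟨j, h, hj⟩ := exists_geIncl_comp_eq_zero f ((quotientFunctor_map_eq_zero_iff f).1 h0)
  rw [DirectLimit.eq_of_le (f := restrictHom k n) ⟨i, f⟩ j h]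
  have hr : restrictHom k n i j h f = 0 := by
    rw [restrictHom_apply, ← cancel_mono (geι k n j), restrict_comp_geι, ← Category.assoc, hj,
      zero_comp, zero_comp]
  change (Quotient.mk _ ⟨j, restrictHom k n i j h f⟩ : EndLimit k n) = 0
  rw [hr]
  exact (DirectLimit.zero_def j).symm

/-- An endomorphism of `𝒪` is represented by a map `R_{≥ i} → R`; being degree-preserving, this map
takes values in `R_{≥ i}`. -/
theorem endLimitHom_surjective : Function.Surjective (endLimitHom k n) := by
  intro φ
  obtain ⟨i, f, hf⟩ := exists_ge_hom φ
  refine ⟨Quotient.mk _ ⟨i, GrMod.subLift _ (isGraded_geIdeal k n i) f (mem_geIdeal k n f)⟩, ?_⟩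
  rw [endLimitHom_mk, ← cancel_epi ((π).map (geι k n i)), map_geι_geEndHom, ← Functor.map_comp,
    GrMod.subLift_comp_subι]
  exact hf.symm

end FreeAlg

theorem mainTheorem4 (k : Type u) [Field k] (n : ℕ) :
    -- `𝒪` is a progenerator: finitely generated, projective, and a generator
    (IsFinitelyGeneratedObject (FreeAlg.structureSheaf k n) ∧
      Projective (FreeAlg.structureSheaf k n) ∧
      IsSeparator (FreeAlg.structureSheaf k n)) ∧
    -- `Hom(𝒪, -)` is an equivalence onto right modules over `End 𝒪`
    (preadditiveCoyonedaObj (FreeAlg.structureSheaf k n) :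
      QGr (FreeAlg.grading k n) ⥤
        ModuleCat.{u} (End (FreeAlg.structureSheaf k n))ᵐᵒᵖ).IsEquivalence ∧
    -- the inclusions induce isomorphisms `π* R_{≥ i} → 𝒪`, and the algebra `End 𝒪` is the direct
    -- limit of the algebras `End(R_{≥ i})`, where the class of `f : R_{≥ i} → R_{≥ i}` corresponds
    -- to the endomorphism of `𝒪` that `π* f` becomes under this isomorphism
    (∀ i : ℕ, IsIso ((QGr.quotientFunctor (FreeAlg.grading k n)).map (FreeAlg.geι k n i))) ∧
    ∃ e : FreeAlg.EndLimit k n ≃ₐ[k] End (FreeAlg.structureSheaf k n),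
      ∀ (i : ℕ) (f : End (FreeAlg.ge k n i)),
        (QGr.quotientFunctor (FreeAlg.grading k n)).map (FreeAlg.geι k n i) ≫
            e (Quotient.mk _ ⟨i, f⟩) =
          (QGr.quotientFunctor (FreeAlg.grading k n)).map f ≫
            (QGr.quotientFunctor (FreeAlg.grading k n)).map (FreeAlg.geι k n i) := by
  have hG := FreeAlg.isSeparator_structureSheaf (k := k) (n := n)
  have hP := fun I : Type u => (⟨_, _, FreeAlg.isSpanningCopower_directSum I⟩ :
    ∃ (P : QGr (FreeAlg.grading k n)) (i : I → (FreeAlg.structureSheaf k n ⟶ P)),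
      IsSpanningCopower i)
  exact ⟨⟨isFinitelyGeneratedObject_of_isSeparator hG hP, inferInstance, hG⟩,
    isEquivalence_preadditiveCoyonedaObj hG hP, FreeAlg.isIso_map_geι,
    AlgEquiv.ofBijective (FreeAlg.endLimitHom k n)
      ⟨FreeAlg.endLimitHom_injective k n, FreeAlg.endLimitHom_surjective k n⟩,
    FreeAlg.map_geι_geEndHom k n⟩
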